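/- All graphs are finite, simple and undirected; $N_G(x)$ is the set of neighbors of $x$ and $G[X]$ the subgraph induced by $X$. A \emph{propeller} is a graph consisting of a chordless cycle (of length at least 3) and one further node that has at least two neighbors on the cycle. Let $\mathcal C_0$ be the class of graphs in which no node has two or more neighbors of degree at least 3, and let $\mathcal C_2$ be the class of graphs that contain no propeller as an induced subgraph. A graph is \emph{2-connected} if it is non-empty and every node set $S$ such that $G\setminus S$ is disconnected or has only one node has at least two elements. A \emph{$K_2$-cutset} of $G$ is a set of two adjacent nodes whose deletion leaves more than one connected component. A \emph{split} $(S,K',K'')$ of $S\subseteq V(G)$ consists of two disjoint non-empty sets $K',K''$ with $K'\cup K''=V(G)\setminus S$ and no edge of $G$ between $K'$ and $K''$. A pair $S=\{u,v\}$ of distinct non-adjacent nodes is a \emph{proper $S_2$-cutset} if it has a split $(S,K',K'')$ such that neither $G[K'\cup S]$ nor $G[K''\cup S]$ is a chordless path from $u$ to $v$; splits of a proper $S_2$-cutset are understood to have this property. The \emph{block} of such a split that contains $K'$ is obtained from $G[K'\cup S]$ by adding two new nodes $u',v'$ and the edges $uu',u'v',v'v$; the block containing $K''$ is defined in the same way.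 A set $S=\{u,v,w\}$ of three distinct nodes inducing exactly one edge, say $uv$, is an \emph{$I$-cutset} if it has a split $(S,K',K'')$ such that some connected component of $G[K']$ contains a neighbor of each of $u,v,w$, and so does some connected component of $G[K'']$; splits of an $I$-cutset are understood to have this property. It is \emph{proper} if no node outside $S$ has two or more neighbors in $S$. The \emph{block} of such a split that contains $K'$ is obtained from $G[K'\cup S]$ by adding four new nodes $u_1',u_2',v_1',v_2'$ and the edges $uu_1',u_1'u_2',u_2'w,vv_1',v_1'v_2',v_2'w$; the block containing $K''$ is defined in the same way. \textbf{Lemma (extreme decomposition).} Let $G$ be a 2-connected graph in $\mathcal C_2\setminus\mathcal C_0$ that has no $K_2$-cutset. Then there exists $S\subseteq V(G)$ such that (i) $S$ is a proper $I$-cutset or a proper $S_2$-cutset of $G$; (ii) there is a split $(S,K',K'')$ such that at least one of its two blocks, say $G'$, belongs to $\mathcal C_0$; and (iii) all nodes of $S$ have degree at least 3 in $G'$. -/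

import Mathlib

namespace PropellerFree

variable {V : Type*}

/-- The degree of a node (used for finite graphs only). -/
noncomputable def deg (G : SimpleGraph V) (v : V) : ℕ := (G.neighborSet v).ncard

/-- `G ∖ S`. -/
abbrev del (G : SimpleGraph V) (S : Set V) : SimpleGraph ↥(Sᶜ) := G.induce Sᶜ

/-- `S` is a node cutset of `G`: the graph `G ∖ S` has more than one connected component. -/
def IsNodeCutset (G : SimpleGraph V) (S : Set V) : Prop := ¬ (del G S).Preconnected

/-- `G` is `k`-connected: every node set `S` such that `G ∖ S` is disconnected or has only one
node has size at least `k`. -/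
def IsKConnected (G : SimpleGraph V) (k : ℕ) : Prop :=
  Nonempty V ∧ ∀ S : Set V, (IsNodeCutset G S ∨ Sᶜ.ncard = 1) → k ≤ S.ncard

/-- `C` is the node set of a chordless cycle of `G` (of length at least 3), that is, `C` induces
a cycle in `G`. -/
def IsChordlessCycle (G : SimpleGraph V) (C : Set V) : Prop :=
  ∃ n : ℕ, 3 ≤ n ∧ Nonempty (SimpleGraph.cycleGraph n ≃g G.induce C)

/-- A propeller: a graph consisting of a chordless cycle (the rim) and one more node `x`
(the center) that has at least two neighbors on the rim. -/
def IsPropeller {W : Type*} (H : SimpleGraph W) : Prop :=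
  ∃ x : W, IsChordlessCycle H {x}ᶜ ∧ 2 ≤ deg H x

/-- The class `𝒞₀`: no node has at least two neighbors of degree at least three. -/
def InC0 (G : SimpleGraph V) : Prop :=
  ∀ v : V, ¬ 2 ≤ {w | G.Adj v w ∧ 3 ≤ deg G w}.ncard

/-- The class `𝒞₂`: no induced subgraph is a propeller. -/
def InC2 (G : SimpleGraph V) : Prop :=
  ∀ X : Set V, ¬ IsPropeller (G.induce X)

/-- `G` has a `K₂`-cutset: a node cutset consisting of two adjacent nodes. -/
def HasK2Cutset (G : SimpleGraph V) : Prop :=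
  ∃ a b : V, G.Adj a b ∧ IsNodeCutset G {a, b}

/-- `(S, A, B)` is a split: `A` and `B` are nonempty, they partition `V(G) ∖ S`, and no edge of
`G` has one end in `A` and the other in `B`. -/
structure IsSplit (G : SimpleGraph V) (S A B : Set V) : Prop where
  union_eq : A ∪ B = Sᶜ
  disjoint : Disjoint A B
  left_nonempty : A.Nonempty
  right_nonempty : B.Nonempty
  not_adj : ∀ a ∈ A, ∀ b ∈ B, ¬ G.Adj a b

/-- `G[X]` is a chordless `ab`-path. -/
def IsChordlessPath (G : SimpleGraph V) (X : Set V) (a b : V) : Prop :=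
  ∃ (n : ℕ) (p : SimpleGraph.pathGraph (n + 1) ↪g G),
    Set.range p = X ∧ p 0 = a ∧ p (Fin.last n) = b

/-- `({u, v}, A, B)` is a split of a proper `S₂`-cutset: `u` and `v` are distinct nonadjacent
nodes, and neither `G[A ∪ {u, v}]` nor `G[B ∪ {u, v}]` is a chordless `uv`-path. -/
structure IsProperS2Split (G : SimpleGraph V) (u v : V) (A B : Set V) : Prop where
  ne : u ≠ v
  not_adj : ¬ G.Adj u v
  split : IsSplit G {u, v} A B
  left_not_path : ¬ IsChordlessPath G (A ∪ {u, v}) u v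
  right_not_path : ¬ IsChordlessPath G (B ∪ {u, v}) u v

/-- Some connected component of `G[A]` contains a neighbor of every node of `S`. -/
def HasFullComponent (G : SimpleGraph V) (S A : Set V) : Prop :=
  ∃ C : (G.induce A).ConnectedComponent, ∀ s ∈ S, ∃ x : ↥A, x ∈ C.supp ∧ G.Adj s x

/-- `({u, v, w}, A, B)` is a split of the `I`-cutset `{u, v, w}`, whose only edge is `uv`. -/
structure IsISplit (G : SimpleGraph V) (u v w : V) (A B : Set V) : Prop where
  ne_left : u ≠ w
  ne_right : v ≠ w
  adj : G.Adj u v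
  not_adj_left : ¬ G.Adj u w
  not_adj_right : ¬ G.Adj v w
  split : IsSplit G {u, v, w} A B
  left_component : HasFullComponent G {u, v, w} A
  right_component : HasFullComponent G {u, v, w} B

/-- `({u, v, w}, A, B)` is a split of a proper `I`-cutset: moreover, no node outside `{u, v, w}`
has at least two neighbors in `{u, v, w}`. -/
structure IsProperISplit (G : SimpleGraph V) (u v w : V) (A B : Set V) : Prop where
  isISplit : IsISplit G u v w A B
  proper : ∀ x ∉ ({u, v, w} : Set V), ¬ 2 ≤ (G.neighborSet x ∩ {u, v, w}).ncard

/-- The graph obtained from `H` by adding two new nodes `m₀ = inr 0` and `m₁ = inr 1`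
and the edges `a m₀`, `m₀ m₁` and `m₁ b`. -/
def addPath {W : Type*} (H : SimpleGraph W) (a b : W) : SimpleGraph (W ⊕ Fin 2) where
  Adj
    | .inl x, .inl y => H.Adj x y
    | .inl x, .inr i => (x = a ∧ i = 0) ∨ (x = b ∧ i = 1)
    | .inr i, .inl x => (x = a ∧ i = 0) ∨ (x = b ∧ i = 1)
    | .inr i, .inr j => i ≠ j
  symm := ⟨by
    rintro (x | i) (y | j) h
    · exact H.adj_symm h
    · exact h
    · exact h
    · exact Ne.symm h⟩
  loopless := ⟨by
    rintro (x | i) h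
    · exact H.irrefl h
    · exact h rfl⟩

/-- The block of decomposition containing `K` with respect to a split of a proper `S₂`-cutset
`{u, v}` one of whose sides is `K`: the graph `G[K ∪ {u, v}]` together with two marker nodes
that form a path of length three between `u` and `v`. -/
def s2Block (G : SimpleGraph V) (u v : V) (K : Set V) :
    SimpleGraph (↥(K ∪ {u, v}) ⊕ Fin 2) :=
  addPath (G.induce (K ∪ {u, v})) ⟨u, by simp⟩ ⟨v, by simp⟩

/-- The block of decomposition containing `K` with respect to a split of a proper `I`-cutset
`{u, v, w}` with edge `uv` one of whose sides is `K`: the graph `G[K ∪ {u, v, w}]` together with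
four marker nodes that form a path of length three between `u` and `w` and a path of length three
between `v` and `w`. -/
def iBlock (G : SimpleGraph V) (u v w : V) (K : Set V) :
    SimpleGraph ((↥(K ∪ {u, v, w}) ⊕ Fin 2) ⊕ Fin 2) :=
  addPath (addPath (G.induce (K ∪ {u, v, w})) ⟨u, by simp⟩ ⟨w, by simp⟩)
    (.inl ⟨v, by simp⟩) (.inl ⟨w, by simp⟩)

end PropellerFree

/-!
The cutset is obtained from a side of minimum size, where a side is one part of a split of a proper
`S₂`-cutset or of an `I`-cutset (`IsSide`).

Sides exist because of a separation property of propeller-free graphs. Call a set of nodes an atom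
if no clique of at most two nodes separates it (`Atom`). In a connected atom of a propeller-free
graph, any two nonadjacent nodes lie on a common chordless cycle (`Atom.exists_hole`): such a cycle
can be moved along a path one node at a time, since a node outside a cycle sees at most one node of
it. Hence any two nonadjacent neighbors of a node `x` are separated by `x` together with a clique
of at most two nodes (`exists_clique_separator`), for otherwise a minimal subset of `V ∖ {x}` in
which they are not separated by such a clique is an atom, and `x` is the center of a propeller
whose rim is a cycle through both. A 2-connected graph without `K₂`-cutset is itself an atom, and
triangle-free if it has at least four nodes. So the clique contains no neighbor of `x`
(`Atom.exists_separates`), and if `x` has two neighbors of degree at least three, then `x` and the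
clique form an `S₂`-cutset or an `I`-cutset, and the component of either neighbor is a side
(`Separates.isSide`).

Let `K` be a side of minimum size with cutset `S`. If some node of `K ∪ S` had two neighbors in
`K ∪ S` of degree at least three, then these would be separated in the same way, and the pieces
would contain a side smaller than `K`, or a propeller (`IsS2Side.eq_of_adj`, `IsISide.eq_of_adj`).
Since the marker nodes of the block have degree two, the block belongs to `𝒞₀`. Minimality also
gives each node of an `S₂`-cutset two neighbors in `K` (`IsS2Side.exists_two_adj`), hence degree at
least three in the block, which is automatic for an `I`-cutset. Finally, every `I`-cutset that
arises is proper (`IsISide.eq_of_adj_of_notMem`): most propellers below come from a node that sees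
two nodes joined through two disjoint anticomplete connected sets (`false_of_two_links`).
-/

namespace PropellerFree

variable {V : Type*}

/-! ### Induced paths and holes -/

/-- The list enumerates the nodes of an induced path of `G` in order: each node is distinct from
the later ones, and the first of these is the only one it is adjacent to. -/
def IndPath (G : SimpleGraph V) : List V → Prop
  | [] => True
  | x :: l => IndPath G l ∧ ∀ z ∈ l, x ≠ z ∧ (G.Adj x z ↔ l.head? = some z)

variable {G : SimpleGraph V}

theorem IndPath.append_iff {l₁ l₂ : List V} :
    IndPath G (l₁ ++ l₂) ↔ IndPath G l₁ ∧ IndPath G l₂ ∧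
      ∀ x ∈ l₁, ∀ y ∈ l₂, x ≠ y ∧ (G.Adj x y ↔ l₁.getLast? = some x ∧ l₂.head? = some y) := by
  induction l₁ with
  | nil => simp [IndPath]
  | cons a l ih =>
    rcases l with _ | ⟨b, l⟩
    · simp [IndPath]
    · simp only [List.cons_append, IndPath] at ih ⊢
      simp only [List.getLast?_cons_cons] at ih ⊢
      constructor
      · rintro ⟨h1, h2⟩
        grind
      · grind

theorem IndPath.nodup {l : List V} (h : IndPath G l) : l.Nodup := by
  induction l with
  | nil => simp
  | cons a l ih => simp only [IndPath] at h; grind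

theorem IndPath.reverse {l : List V} (h : IndPath G l) : IndPath G l.reverse := by
  induction l with
  | nil => simp [IndPath]
  | cons a l ih =>
    have hn := h.nodup
    simp only [IndPath] at h
    simp only [List.reverse_cons, IndPath.append_iff]
    refine ⟨ih h.1, by simp [IndPath], ?_⟩
    intro x hx y hy
    have := h.2 x (by simpa using hx)
    have := G.adj_comm x y
    simp at hy
    subst hy
    grind

/-- `x` followed by `m` enumerates a chordless cycle of `G` in cyclic order: `m` is an induced path
with at least two nodes, and `x` sees exactly its two ends. Triangles are allowed. -/
structure IsHole (G : SimpleGraph V) (x : V) (m : List V) : Prop where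
  path : IndPath G m
  two_le : 2 ≤ m.length
  notMem : x ∉ m
  adj : ∀ z ∈ m, G.Adj x z ↔ m.head? = some z ∨ m.getLast? = some z

/-! ### Holes in propeller-free graphs -/

theorem IsHole.reverse {x : V} {m : List V} (h : IsHole G x m) : IsHole G x m.reverse where
  path := h.path.reverse
  two_le := by simpa using h.two_le
  notMem := by simpa using h.notMem
  adj z hz := by
    have := h.adj z (by simpa using hz)
    simp only [List.head?_reverse, List.getLast?_reverse]
    tauto

/-- A hole can be read off from any of its nodes. -/
theorem IsHole.rotate {x y : V} {l m : List V} (h : IsHole G x (l ++ y :: m)) :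
    IsHole G y (m ++ x :: l) := by
  obtain ⟨hp, h2, hn, ha⟩ := h
  have hnd := hp.nodup
  rw [IndPath.append_iff] at hp
  obtain ⟨hl, hm, hlm⟩ := hp
  simp only [IndPath] at hm
  have hx : ∀ z, G.Adj x z ↔ G.Adj z x := fun z => G.adj_comm x z
  have hy : ∀ z, G.Adj y z ↔ G.Adj z y := fun z => G.adj_comm y z
  have hlm' : ∀ z ∈ m, ∀ w ∈ l, G.Adj z w ↔ False := by
    intro z hz w hw
    have := hlm w hw z (by simp [hz])
    rw [G.adj_comm]
    grind
  refine ⟨?_, by grind, by grind, ?_⟩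
  · rw [IndPath.append_iff]
    refine ⟨hm.1, ?_, ?_⟩
    · simp only [IndPath]
      refine ⟨hl, ?_⟩
      intro z hz
      have := ha z (by simp [hz])
      rcases l with _ | ⟨a, l⟩
      · grind
      · rcases m.eq_nil_or_concat with rfl | ⟨m, b, rfl⟩ <;> grind
    · intro z hz w hw
      rcases m.eq_nil_or_concat with rfl | ⟨m, b, rfl⟩
      · grind
      · rcases l with _ | ⟨a, l⟩ <;> grind
  · intro z hz
    have hzl : z ∈ m ∨ z = x ∨ z ∈ l := by simpa using hz
    have h1 : ∀ z, (m ++ x :: l).head? = some z ↔ (m ++ [x]).head? = some z := by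
      rcases m with _ | ⟨b, m⟩ <;> simp
    have h2 : ∀ z, (m ++ x :: l).getLast? = some z ↔ (x :: l).getLast? = some z := by
      simp
    rw [h1, h2]
    rcases hzl with hzm | rfl | hzl
    · have := hm.2 z hzm
      rw [this.2]
      rcases m with _ | ⟨b, m⟩
      · simp at hzm
      · have : (x :: l).getLast? ≠ some z := by
          intro h
          have := List.mem_of_getLast? h
          grind
        simp [this]
    · rw [hy, ha y (by simp)]
      rcases m with _ | ⟨b, m⟩
      · simp
      · have : (l ++ y :: b :: m).getLast? ≠ some y := by
          intro h
          have : (b :: m).getLast? = some y := by simpa using h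
          have := List.mem_of_getLast? this
          grind
        rcases l with _ | ⟨a, l⟩
        · simp
        · have h3 : (a :: l).getLast? ≠ some z := by
            intro h
            have := List.mem_of_getLast? h
            grind
          have h4 : b ≠ z := by grind
          have h5 : a ≠ y := by grind
          simp_all
    · rw [hy, (hlm z hzl y (by simp)).2]
      have h3 : (m ++ [x]).head? ≠ some z := by
        intro h
        have := List.mem_of_head? h
        grind
      rcases l with _ | ⟨a, l⟩
      · simp at hzl
      · simp only [h3, false_or, List.getLast?_cons_cons, List.head?_cons, and_true]

theorem IndPath.adj_getElem_iff {l : List V} (h : IndPath G l) {i j : ℕ} (hij : i < j)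
    (hj : j < l.length) : G.Adj l[i] l[j] ↔ j = i + 1 := by
  induction l generalizing i j with
  | nil => simp at hj
  | cons a l ih =>
    have hn := h.nodup
    simp only [IndPath] at h
    obtain ⟨j, rfl⟩ : ∃ k, j = k + 1 := ⟨j - 1, by omega⟩
    rcases i with _ | i
    · have := h.2 (l[j]'(by simpa using hj)) (by simp)
      have hl : 0 < l.length := by grind
      simp only [List.getElem_cons_zero, List.getElem_cons_succ]
      rw [this.2, List.head?_eq_getElem?, List.getElem?_eq_getElem hl]
      have := (List.nodup_cons.1 hn).2.getElem_inj_iff (i := 0) (j := j) (hi := hl) (hj := by grind)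
      grind
    · simpa using ih h.1 (i := i) (j := j) (by omega) (by simpa using hj)

theorem IsHole.adj_getElem_iff {x : V} {m : List V} (h : IsHole G x m) {i j : ℕ} (hij : i < j)
    (hj : j < (x :: m).length) :
    G.Adj (x :: m)[i] (x :: m)[j] ↔ j = i + 1 ∨ (i = 0 ∧ j = m.length) := by
  have hn := h.path.nodup
  have h2 := h.two_le
  obtain ⟨j, rfl⟩ : ∃ k, j = k + 1 := ⟨j - 1, by omega⟩
  rcases i with _ | i
  · have := h.adj (m[j]'(by simpa using hj)) (by simp)
    simp only [List.getElem_cons_zero, List.getElem_cons_succ]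
    rw [this, List.head?_eq_getElem?, List.getLast?_eq_getElem?,
      List.getElem?_eq_getElem (by omega), List.getElem?_eq_getElem (by omega)]
    have h1 := hn.getElem_inj_iff (i := 0) (j := j) (hi := by omega) (hj := by grind)
    have h2 := hn.getElem_inj_iff (i := m.length - 1) (j := j) (hi := by omega) (hj := by grind)
    grind
  · have := h.path.adj_getElem_iff (i := i) (j := j) (by omega) (by simpa using hj)
    simp only [List.getElem_cons_succ]
    grind

theorem IsHole.nodup {x : V} {m : List V} (h : IsHole G x m) : (x :: m).Nodup :=
  List.nodup_cons.2 ⟨h.notMem, h.path.nodup⟩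

/-- The only use of the hypothesis that `G` contains no propeller: a node outside a hole sees at
most one node of it. -/
theorem IsHole.eq_of_adj {x y a b : V} {m : List V} (hG : InC2 G) (h : IsHole G x m)
    (hy : y ∉ x :: m) (ha : a ∈ x :: m) (hb : b ∈ x :: m) (hya : G.Adj y a) (hyb : G.Adj y b) :
    a = b := by
  classical
  by_contra hab
  set L := x :: m with hL
  let X : Set V := {v | v = y ∨ v ∈ L}
  have hyX : y ∈ X := Or.inl rfl
  have hLX : ∀ v ∈ L, v ∈ X := fun v hv => Or.inr hv
  refine hG X ⟨⟨y, hyX⟩, ⟨L.length, by have := h.two_le; simp [hL]; omega, ⟨?_⟩⟩, ?_⟩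
  · let f : Fin L.length → ↥({(⟨y, hyX⟩ : X)}ᶜ : Set X) := fun i =>
      ⟨⟨L[i], hLX _ (by simp)⟩, by
        intro hc
        have hc' : L[i] = y := congrArg Subtype.val (Set.mem_singleton_iff.1 hc)
        exact hy (hc' ▸ List.getElem_mem _)⟩
    have hf : Function.Bijective f := by
      constructor
      · intro i j hij
        have : L[i] = L[j] := congrArg (fun z => z.1.1) hij
        exact Fin.ext ((h.nodup.getElem_inj_iff).1 this)
      · rintro ⟨⟨v, hv⟩, hv'⟩
        rcases hv with rfl | hv
        · exact absurd rfl hv'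
        · obtain ⟨i, hi, rfl⟩ := List.getElem_of_mem hv
          exact ⟨⟨i, hi⟩, rfl⟩
    refine ⟨Equiv.ofBijective f hf, ?_⟩
    intro i j
    change G.Adj L[i] L[j] ↔ _
    have hlen : L.length = m.length + 1 := by simp [hL]
    have h2 := h.two_le
    have hi := i.2
    have hj := j.2
    have key : (SimpleGraph.cycleGraph L.length).Adj i j ↔
        (j.1 = i.1 + 1 ∨ (i.1 = 0 ∧ j.1 = m.length)) ∨
        (i.1 = j.1 + 1 ∨ (j.1 = 0 ∧ i.1 = m.length)) := by
      rw [SimpleGraph.cycleGraph_adj']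
      rcases le_total i j with hle | hle
      · rcases hle.eq_or_lt with rfl | hlt
        · have : ((i - i : Fin L.length) : ℕ) = 0 := by
            rw [Fin.coe_sub_iff_le.2 le_rfl]; simp
          rw [this]; omega
        · have h1 := Fin.coe_sub_iff_le.2 hle
          have h2 := Fin.coe_sub_iff_lt.2 hlt
          have hlt' : i.1 < j.1 := hlt
          rw [h1, h2]; omega
      · rcases hle.eq_or_lt with rfl | hlt
        · have : ((j - j : Fin L.length) : ℕ) = 0 := by
            rw [Fin.coe_sub_iff_le.2 le_rfl]; simp
          rw [this]; omega
        · have h1 := Fin.coe_sub_iff_le.2 hle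
          have h2 := Fin.coe_sub_iff_lt.2 hlt
          have hlt' : j.1 < i.1 := hlt
          rw [h1, h2]; omega
    rw [key]
    rcases lt_trichotomy i.1 j.1 with hlt | heq | hlt
    · have := h.adj_getElem_iff hlt hj
      simp only [Fin.getElem_fin]
      rw [this]; omega
    · have hij : i = j := Fin.ext heq
      subst hij
      exact ⟨fun h => absurd h G.irrefl, fun h => by omega⟩
    · have := h.adj_getElem_iff hlt hi
      simp only [Fin.getElem_fin]
      rw [G.adj_comm, this]; omega
  · have hsub : ({⟨a, hLX a ha⟩, ⟨b, hLX b hb⟩} : Set X) ⊆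
        (G.induce X).neighborSet ⟨y, hyX⟩ := by
      rintro z (rfl | rfl)
      · exact hya
      · exact hyb
    have hfin : Finite X := by
      have : X = (insert y {v | v ∈ L}) := by ext; simp [X]
      rw [this]
      exact ((List.finite_toSet L).insert y)
    have h2 : ({⟨a, hLX a ha⟩, ⟨b, hLX b hb⟩} : Set X).ncard = 2 :=
      Set.ncard_pair (by simpa using hab)
    rw [deg, ← h2]
    exact Set.ncard_le_ncard hsub (Set.toFinite _)

/-! ### Reachability inside a node set -/

theorem exists_split_first {α : Type*} {p : α → Prop} {l : List α} (h : ∃ y ∈ l, p y) :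
    ∃ l₁ y l₂, l = l₁ ++ y :: l₂ ∧ p y ∧ ∀ z ∈ l₁, ¬ p z := by
  induction l with
  | nil => simp at h
  | cons a l ih =>
    by_cases ha : p a
    · exact ⟨[], a, l, rfl, ha, by simp⟩
    · obtain ⟨l₁, y, l₂, rfl, hy, hz⟩ := ih (by
        obtain ⟨y, hy, hp⟩ := h
        rcases List.mem_cons.1 hy with rfl | hy
        · exact absurd hp ha
        · exact ⟨y, hy, hp⟩)
      exact ⟨a :: l₁, y, l₂, rfl, hy, by simpa [ha] using hz⟩

theorem exists_split_last {α : Type*} {p : α → Prop} {l : List α} (h : ∃ y ∈ l, p y) :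
    ∃ l₁ y l₂, l = l₁ ++ y :: l₂ ∧ p y ∧ ∀ z ∈ l₂, ¬ p z := by
  obtain ⟨l₁, y, l₂, hl, hy, hz⟩ := exists_split_first (l := l.reverse) (p := p) (by simpa using h)
  refine ⟨l₂.reverse, y, l₁.reverse, ?_, hy, by simpa using hz⟩
  rw [← List.reverse_reverse l, hl]
  simp

/-- `b` can be reached from `a` by a walk of `G` all of whose nodes belong to `A`. -/
def Reach (G : SimpleGraph V) (A : Set V) (a b : V) : Prop :=
  a ∈ A ∧ Relation.ReflTransGen (fun x y => G.Adj x y ∧ y ∈ A) a b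

namespace Reach

variable {A B : Set V} {a b c : V}

theorem refl (h : a ∈ A) : Reach G A a a := ⟨h, .refl⟩

theorem mem_right (h : Reach G A a b) : b ∈ A := by
  rcases Relation.ReflTransGen.cases_tail h.2 with rfl | ⟨c, _, hc⟩
  · exact h.1
  · exact hc.2

theorem trans (h : Reach G A a b) (h' : Reach G A b c) : Reach G A a c := ⟨h.1, h.2.trans h'.2⟩

theorem tail (h : Reach G A a b) (h' : G.Adj b c) (hc : c ∈ A) : Reach G A a c :=
  ⟨h.1, h.2.tail ⟨h', hc⟩⟩

theorem of_adj (ha : a ∈ A) (hb : b ∈ A) (h : G.Adj a b) : Reach G A a b :=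
  (refl ha).tail h hb

theorem symm (h : Reach G A a b) : Reach G A b a := by
  obtain ⟨ha, h⟩ := h
  induction h with
  | refl => exact refl ha
  | tail h1 h2 ih => exact (of_adj h2.2 (mem_right ⟨ha, h1⟩) h2.1.symm).trans ih

theorem mono (h : Reach G A a b) (hAB : A ⊆ B) : Reach G B a b := by
  obtain ⟨ha, h⟩ := h
  induction h with
  | refl => exact refl (hAB ha)
  | tail _ h2 ih => exact ih.tail h2.1 (hAB h2.2)

theorem exists_indPath (h : Reach G A a b) :
    ∃ l, IndPath G l ∧ l.head? = some a ∧ l.getLast? = some b ∧ ∀ z ∈ l, z ∈ A := by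
  obtain ⟨ha, h⟩ := h
  induction h using Relation.ReflTransGen.head_induction_on with
  | refl => exact ⟨[b], by simp [IndPath], rfl, rfl, by simpa using ha⟩
  | @head a c h1 h2 ih =>
    obtain ⟨l, hl, hc, hb, hA⟩ := ih h1.2
    by_cases hal : a ∈ l
    · obtain ⟨l₁, l₂, rfl⟩ := List.append_of_mem hal
      exact ⟨a :: l₂, (IndPath.append_iff.1 hl).2.1, rfl, by simpa using hb, by grind⟩
    · obtain ⟨l₁, y, l₂, rfl, hy, hz⟩ := exists_split_last (l := l) (p := G.Adj a)
        ⟨c, List.mem_of_head? hc, h1.1⟩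
      refine ⟨a :: y :: l₂, ?_, rfl, by simpa using hb, by grind⟩
      refine ⟨(IndPath.append_iff.1 hl).2.1, ?_⟩
      have := hl.nodup
      grind

theorem exists_indPath_cons (h : Reach G A a b) (hab : a ≠ b) :
    ∃ l, IndPath G (a :: (l ++ [b])) ∧ ∀ z ∈ a :: (l ++ [b]), z ∈ A := by
  obtain ⟨l, hl, ha, hb, hA⟩ := h.exists_indPath
  rcases l with _ | ⟨x, l⟩
  · simp at ha
  · obtain rfl : x = a := by simpa using ha
    rcases l.eq_nil_or_concat with rfl | ⟨l, y, rfl⟩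
    · simp at hb; exact absurd hb hab
    · obtain rfl : y = b := by simpa [List.getLast?_cons] using hb
      exact ⟨l, by simpa using hl, by simpa using hA⟩

end Reach

/-- `D` induces a connected subgraph of `G`; the empty set is allowed. -/
def SConn (G : SimpleGraph V) (D : Set V) : Prop := ∀ a ∈ D, ∀ b ∈ D, Reach G D a b

/-- Two nonadjacent nodes that both have neighbors in a connected set are joined by an induced path
with interior in this set. -/
theorem SConn.exists_link {D : Set V} {s t : V} (hD : SConn G D) (hst : ¬ G.Adj s t) (hne : s ≠ t)
    (hs : ∃ d ∈ D, G.Adj s d) (ht : ∃ d ∈ D, G.Adj t d) :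
    ∃ l, l ≠ [] ∧ IndPath G (s :: (l ++ [t])) ∧ ∀ z ∈ l, z ∈ D := by
  obtain ⟨d, hd, hsd⟩ := hs
  obtain ⟨e, he, hte⟩ := ht
  have h : Reach G (insert s (insert t D)) s t :=
    ((Reach.of_adj (by simp) (by simp [hd]) hsd).trans
      ((hD d hd e he).mono fun z hz => by simp [hz])).tail hte.symm (by simp)
  obtain ⟨l, hl, hA⟩ := h.exists_indPath_cons hne
  have hn := hl.nodup
  refine ⟨l, ?_, hl, ?_⟩
  · rintro rfl
    simp [IndPath] at hl
    exact hst hl.2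
  · intro z hz
    have := hA z (by simp [hz])
    grind

/-- Two induced paths from `s` to `t` with nonempty anticomplete interiors form a hole. -/
theorem IsHole.of_links {s t : V} {l₁ l₂ : List V} (h₁ : IndPath G (s :: (l₁ ++ [t])))
    (h₂ : IndPath G (s :: (l₂ ++ [t]))) (hne₁ : l₁ ≠ []) (hne₂ : l₂ ≠ [])
    (h : ∀ x ∈ l₁, ∀ y ∈ l₂, x ≠ y ∧ ¬ G.Adj x y) : IsHole G s (l₁ ++ t :: l₂.reverse) := by
  have hn₁ := h₁.nodup
  have hn₂ := h₂.nodup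
  obtain ⟨h₁', hs₁⟩ := h₁
  have h₂' := h₂.1
  have hs₂ := h₂.2
  have hr : IndPath G (t :: l₂.reverse) := by
    have := h₂'.reverse
    simpa using this
  rw [IndPath.append_iff] at h₁' h₂'
  refine ⟨?_, ?_, ?_, ?_⟩
  · rw [IndPath.append_iff]
    refine ⟨h₁'.1, hr, ?_⟩
    intro x hx y hy
    rcases List.mem_cons.1 hy with rfl | hy
    · exact ⟨(h₁'.2.2 x hx y (by simp)).1, by simpa using (h₁'.2.2 x hx y (by simp)).2⟩
    · have := h x hx y (by simpa using hy)
      refine ⟨this.1, ?_⟩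
      have hty : t ≠ y := by grind
      simp [this.2, hty]
  · have := List.length_pos_of_ne_nil hne₁
    grind
  · grind
  · intro z hz
    rcases l₁ with _ | ⟨a, l₁⟩
    · exact absurd rfl hne₁
    rcases l₂ with _ | ⟨b, l₂⟩
    · exact absurd rfl hne₂
    have h1 : ((a :: l₁) ++ t :: (b :: l₂).reverse).head? = some a := by simp
    have h2 : ((a :: l₁) ++ t :: (b :: l₂).reverse).getLast? = some b := by
      rw [List.getLast?_append_of_ne_nil _ (by simp), List.reverse_cons, ← List.cons_append]
      exact List.getLast?_concat
    rw [h1, h2]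
    have hz' : z ∈ (a :: l₁) ∨ z = t ∨ z ∈ b :: l₂ := by grind
    have e1 := h a (by simp) b (by simp)
    rcases hz' with hz' | rfl | hz'
    · have := hs₁ z (by simp at hz' ⊢; tauto)
      rw [this.2]
      have : z ≠ b := (h z hz' b (by simp)).1
      simp [this.symm]
    · have := hs₁ z (by simp)
      rw [this.2]
      have : b ≠ z := by grind
      simp [this]
    · have := hs₂ z (by simp at hz' ⊢; tauto)
      rw [this.2]
      have : a ≠ z := (h a (by simp) z hz').1
      simp [this]

/-- A hole can be based at any of its nodes. -/
theorem IsHole.exists_base {x y : V} {m : List V} (h : IsHole G x m) (hy : y ∈ x :: m) :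
    ∃ m', IsHole G y m' ∧ ∀ z, z ∈ y :: m' ↔ z ∈ x :: m := by
  rcases List.mem_cons.1 hy with rfl | hy
  · exact ⟨m, h, fun _ => Iff.rfl⟩
  · obtain ⟨l₁, l₂, rfl⟩ := List.append_of_mem hy
    exact ⟨_, h.rotate, by grind⟩

/-- A hole can be based at any of its edges. -/
theorem IsHole.exists_edge {x y w : V} {m : List V} (h : IsHole G x m) (hy : y ∈ x :: m)
    (hw : w ∈ x :: m) (hyw : G.Adj y w) :
    ∃ m', IsHole G y (w :: m') ∧ ∀ z, z ∈ y :: w :: m' ↔ z ∈ x :: m := by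
  obtain ⟨m', h', hm'⟩ := h.exists_base hy
  have hwm : w ∈ m' := by
    rcases List.mem_cons.1 ((hm' w).2 hw) with rfl | h
    · exact absurd hyw G.irrefl
    · exact h
  rcases (h'.adj w hwm).1 hyw with hh | hh
  · rcases m' with _ | ⟨a, m'⟩
    · simp at hh
    · obtain rfl : a = w := by simpa using hh
      exact ⟨m', h', hm'⟩
  · have h'' := h'.reverse
    have hh' : m'.reverse.head? = some w := by simpa using hh
    rcases hr : m'.reverse with _ | ⟨a, m''⟩
    · simp [hr] at hh'
    · rw [hr] at hh' h''
      obtain rfl : a = w := by simpa using hh'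
      refine ⟨m'', h'', fun z => ?_⟩
      rw [← hm' z, ← hr]
      simp

/-! ### Holes through an edge -/

/-- Two induced paths joined by the edge from the end of the first to the start of the second,
closed by a node `x` that sees exactly the two remaining ends. -/
theorem IsHole.of_append {x : V} {l₁ l₂ : List V} (h₁ : IndPath G l₁) (h₂ : IndPath G l₂)
    (hne₁ : l₁ ≠ []) (hne₂ : l₂ ≠ [])
    (h : ∀ y ∈ l₁, ∀ z ∈ l₂, y ≠ z ∧ (G.Adj y z ↔ l₁.getLast? = some y ∧ l₂.head? = some z))
    (hx₁ : ∀ z ∈ l₁, x ≠ z ∧ (G.Adj x z ↔ l₁.head? = some z))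
    (hx₂ : ∀ z ∈ l₂, x ≠ z ∧ (G.Adj x z ↔ l₂.getLast? = some z)) : IsHole G x (l₁ ++ l₂) := by
  have p₁ := List.length_pos_of_ne_nil hne₁
  have p₂ := List.length_pos_of_ne_nil hne₂
  refine ⟨IndPath.append_iff.2 ⟨h₁, h₂, h⟩, by simp; omega, by grind, ?_⟩
  intro z hz
  rw [List.head?_append_of_ne_nil _ hne₁, List.getLast?_append_of_ne_nil _ hne₂]
  have e₁ : ∀ w, l₁.head? = some w → w ∈ l₁ := fun w hw => List.mem_of_head? hw
  have e₂ : ∀ w, l₂.getLast? = some w → w ∈ l₂ := fun w hw => List.mem_of_getLast? hw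
  rcases List.mem_append.1 hz with hz | hz
  · have := hx₁ z hz
    grind
  · have := hx₂ z hz
    grind

/-- `u v` is an edge and `l` is an induced path from a neighbor of `v` to a neighbor of `u` that
closes it to a hole. -/
structure EdgeHole (G : SimpleGraph V) (u v : V) (l : List V) : Prop where
  adj : G.Adj u v
  path : IndPath G l
  ne_nil : l ≠ []
  left : ∀ z ∈ l, u ≠ z ∧ (G.Adj u z ↔ l.getLast? = some z)
  right : ∀ z ∈ l, v ≠ z ∧ (G.Adj v z ↔ l.head? = some z)

theorem EdgeHole.symm {u v : V} {l : List V} (h : EdgeHole G u v l) :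
    EdgeHole G v u l.reverse where
  adj := h.adj.symm
  path := h.path.reverse
  ne_nil := by simpa using h.ne_nil
  left := by simpa using h.right
  right := by simpa using h.left

theorem isHole_cons_iff {u v : V} {l : List V} : IsHole G u (v :: l) ↔ EdgeHole G u v l := by
  constructor
  · intro h
    have hne : l ≠ [] := by
      rintro rfl
      simpa using h.two_le
    have hn := h.notMem
    have hp := h.path
    have ha := h.adj
    have hnd := hp.nodup
    simp only [IndPath] at hp
    have hl : (v :: l).getLast? = l.getLast? := by
      rw [← List.singleton_append, List.getLast?_append_of_ne_nil _ hne]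
    rw [hl] at ha
    refine ⟨(ha v (by simp)).2 (by simp), hp.1, hne, ?_, hp.2⟩
    intro z hz
    have := ha z (by simp [hz])
    have : v ≠ z := by grind
    grind
  · intro h
    obtain ⟨h1, h2, h3, h4, h5⟩ := h
    have := IsHole.of_append (x := u) (l₁ := [v]) (l₂ := l) (by simp [IndPath]) h2 (by simp) h3
      (by simpa using h5) (by simpa [h1] using h1.ne) h4
    simpa using this

theorem EdgeHole.eq_of_adj {u v y a b : V} {l : List V} (hG : InC2 G) (h : EdgeHole G u v l)
    (hy : y ∉ u :: v :: l) (ha : a ∈ u :: v :: l) (hb : b ∈ u :: v :: l) (hya : G.Adj y a)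
    (hyb : G.Adj y b) : a = b :=
  (isHole_cons_iff.2 h).eq_of_adj hG hy ha hb hya hyb

/-- A shortest path between two anticomplete sets `L` and `M`: its interior is nonempty and avoids
both sets, and only the first and the last interior node can have neighbors in `L` and `M`. -/
theorem exists_shortest_link {A L M : Set V} (hLM : ∀ x ∈ L, ∀ y ∈ M, x ≠ y ∧ ¬ G.Adj x y)
    (h : ∃ x ∈ L, ∃ y ∈ M, Reach G A x y) :
    ∃ p ∈ L, ∃ q ∈ M, ∃ R, R ≠ [] ∧ IndPath G (p :: (R ++ [q])) ∧
      (∀ z ∈ R, z ∈ A ∧ z ∉ L ∧ z ∉ M) ∧ (∀ x ∈ L, ∀ z ∈ R, G.Adj x z → R.head? = some z) ∧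
      (∀ y ∈ M, ∀ z ∈ R, G.Adj y z → R.getLast? = some z) := by
  classical
  have hex : ∃ n, ∃ p ∈ L, ∃ q ∈ M, ∃ R : List V, IndPath G (p :: (R ++ [q])) ∧
      (∀ z ∈ R, z ∈ A) ∧ R.length = n := by
    obtain ⟨x, hx, y, hy, h⟩ := h
    obtain ⟨l, hl, hA⟩ := h.exists_indPath_cons (hLM x hx y hy).1
    exact ⟨_, x, hx, y, hy, l, hl, fun z hz => hA z (by simp [hz]), rfl⟩
  obtain ⟨p, hp, q, hq, R, hR, hRA, hn⟩ := Nat.find_spec hex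
  have hmin : ∀ p ∈ L, ∀ q ∈ M, ∀ R' : List V, IndPath G (p :: (R' ++ [q])) →
      (∀ z ∈ R', z ∈ A) → R.length ≤ R'.length := by
    intro p hp q hq R' h1 h2
    rw [hn]
    exact Nat.find_min' hex ⟨p, hp, q, hq, R', h1, h2, rfl⟩
  clear hn
  clear hex h
  have hRL : ∀ z ∈ R, z ∉ L := by
    intro z hz hzL
    obtain ⟨R₁, R₂, rfl⟩ := List.append_of_mem hz
    have h1 : IndPath G ((p :: R₁) ++ (z :: (R₂ ++ [q]))) := by simpa using hR
    have := hmin z hzL q hq R₂ (IndPath.append_iff.1 h1).2.1 (fun w hw => hRA w (by simp [hw]))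
    simp at this
    omega
  have hRM : ∀ z ∈ R, z ∉ M := by
    intro z hz hzM
    obtain ⟨R₁, R₂, rfl⟩ := List.append_of_mem hz
    have h1 : IndPath G ((p :: (R₁ ++ [z])) ++ (R₂ ++ [q])) := by simpa using hR
    have := hmin p hp z hzM R₁ (IndPath.append_iff.1 h1).1 (fun w hw => hRA w (by simp [hw]))
    simp at this
  refine ⟨p, hp, q, hq, R, ?_, hR, fun z hz => ⟨hRA z hz, hRL z hz, hRM z hz⟩, ?_, ?_⟩
  · rintro rfl
    have := hLM p hp q hq
    simp [IndPath] at hR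
    exact this.2 hR.2
  · intro x hx z hz hxz
    obtain ⟨R₁, y, R₂, rfl, hy, hR₂⟩ := exists_split_last (l := R) (p := G.Adj x) ⟨z, hz, hxz⟩
    have h1 : IndPath G ((p :: R₁) ++ (y :: (R₂ ++ [q]))) := by simpa using hR
    have h2 := (IndPath.append_iff.1 h1).2.1
    have h3 : IndPath G (x :: ((y :: R₂) ++ [q])) := by
      refine ⟨h2, fun w hw => ?_⟩
      have h5 := hLM x hx q hq
      have h6 : w = y ∨ w ∈ R₂ ∨ w = q := by simpa using hw
      have h7 := h2.nodup
      have h8 : (y :: R₂ ++ [q]).head? = some y := rfl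
      rw [h8]
      rcases h6 with rfl | h6 | rfl
      · exact ⟨fun h => hRL w (by simp) (h ▸ hx), by simp [hy]⟩
      · have : y ≠ w := by grind
        exact ⟨fun h => hRL w (by simp [h6]) (h ▸ hx), by simp [hR₂ w h6, this]⟩
      · have : y ≠ w := by grind
        exact ⟨h5.1, by simp [h5.2, this]⟩
    have h4 := hmin x hx q hq _ h3 (fun w hw => hRA w (by simp at hw ⊢; tauto))
    have : R₁ = [] := by
      simpa using h4
    subst this
    grind
  · intro x hx z hz hxz
    obtain ⟨R₁, y, R₂, rfl, hy, hR₁⟩ := exists_split_first (l := R) (p := G.Adj x) ⟨z, hz, hxz⟩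
    have h1 : IndPath G ((p :: (R₁ ++ [y])) ++ (R₂ ++ [q])) := by simpa using hR
    have h2 := (IndPath.append_iff.1 h1).1
    have h3 : IndPath G (p :: ((R₁ ++ [y]) ++ [x])) := by
      have : IndPath G ((p :: (R₁ ++ [y])) ++ [x]) := by
        refine IndPath.append_iff.2 ⟨h2, by simp [IndPath], ?_⟩
        intro w hw x' hx'
        obtain rfl : x' = x := by simpa using hx'
        have h5 := hLM p hp x' hx
        have h6 := h2.nodup
        have h7 : (p :: (R₁ ++ [y])).getLast? = some y := by
          rw [← List.cons_append]; exact List.getLast?_concat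
        have h8 := G.adj_comm x' w
        have h9 := G.adj_comm x' p
        rw [h7]
        simp only [List.head?_cons, and_true, Option.some.injEq]
        rcases List.mem_cons.1 hw with rfl | hw
        · grind
        · rcases List.mem_append.1 hw with hw | hw
          · grind
          · grind
      simpa using this
    have h4 := hmin p hp x hx _ h3 (fun w hw => hRA w (by simp at hw ⊢; tauto))
    have : R₂ = [] := by
      simpa using h4
    subst this
    have : z = y := by grind
    simp [this]

/-! ### Two holes with a common edge -/

/-- Two holes `u, v, l₁, p, l₂` and `u, v, m₁, q, m₂` that share the edge `u v` and are otherwise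
anticomplete, together with an induced path `R` that links `p` to `q` and avoids both holes. -/
structure Bridge (G : SimpleGraph V) (u v : V) (l₁ : List V) (p : V) (l₂ m₁ : List V) (q : V)
    (m₂ R : List V) : Prop where
  fst : EdgeHole G u v (l₁ ++ p :: l₂)
  snd : EdgeHole G u v (m₁ ++ q :: m₂)
  anti : ∀ x ∈ l₁ ++ p :: l₂, ∀ y ∈ m₁ ++ q :: m₂, x ≠ y ∧ ¬ G.Adj x y
  path : IndPath G R
  ne_nil : R ≠ []
  left_notMem : u ∉ R
  right_notMem : v ∉ R
  fst_adj : ∀ x ∈ l₁ ++ p :: l₂, ∀ z ∈ R, x ≠ z ∧ (G.Adj x z ↔ x = p ∧ R.head? = some z)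
  snd_adj : ∀ y ∈ m₁ ++ q :: m₂, ∀ z ∈ R, y ≠ z ∧ (G.Adj y z ↔ y = q ∧ R.getLast? = some z)

namespace Bridge

variable {u v p q : V} {l₁ l₂ m₁ m₂ R : List V}

theorem symm (h : Bridge G u v l₁ p l₂ m₁ q m₂ R) :
    Bridge G v u l₂.reverse p l₁.reverse m₂.reverse q m₁.reverse R := by
  obtain ⟨h1, h2, h3, h4, h5, h6, h7, h8, h9⟩ := h
  refine ⟨by simpa using h1.symm, by simpa using h2.symm, ?_, h4, h5, h7, h6, ?_, ?_⟩
  · intro x hx y hy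
    exact h3 x (by simp at hx ⊢; tauto) y (by simp at hy ⊢; tauto)
  · intro x hx
    exact h8 x (by simp at hx ⊢; tauto)
  · intro x hx
    exact h9 x (by simp at hx ⊢; tauto)

/-- The path from `p` through `R` and `q` to the end of the second hole. -/
theorem indPath_right (h : Bridge G u v l₁ p l₂ m₁ q m₂ R) : IndPath G (R ++ q :: m₂) := by
  refine IndPath.append_iff.2 ⟨h.path, (IndPath.append_iff.1 h.snd.path).2.1, ?_⟩
  intro x hx y hy
  have h1 := h.snd_adj y (by simp at hy ⊢; tauto) x hx
  have h2 := G.adj_comm x y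
  grind

theorem head?_eq_some_iff (h : Bridge G u v l₁ p l₂ m₁ q m₂ R) {z : V} :
    (R ++ q :: m₂).head? = some z ↔ R.head? = some z := by
  rw [List.head?_append_of_ne_nil _ h.ne_nil]

/-- The hole that runs from `u` along the end of the first hole to `p`, then along `R` and the end
of the second hole. -/
theorem isHole (h : Bridge G u v l₁ p l₂ m₁ q m₂ R) (hu : ∀ z ∈ R, ¬ G.Adj u z) :
    IsHole G u ((p :: l₂).reverse ++ (R ++ q :: m₂)) := by
  have hpl : IndPath G (p :: l₂) := (IndPath.append_iff.1 h.fst.path).2.1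
  refine IsHole.of_append hpl.reverse h.indPath_right (by simp) (by simp) ?_ ?_ ?_
  · intro x hx y hy
    have hx' : x ∈ p :: l₂ := List.mem_reverse.1 hx
    have hn := hpl.nodup
    rw [h.head?_eq_some_iff, List.getLast?_reverse, List.head?_cons]
    rcases List.mem_append.1 hy with hy | hy
    · have := h.fst_adj x (by simp at hx' ⊢; tauto) y hy
      grind
    · have h1 := h.anti x (by simp at hx' ⊢; tauto) y (by simp at hy ⊢; tauto)
      have h2 : R.head? ≠ some y := fun hh => by
        have := h.snd_adj y (by simp at hy ⊢; tauto) y (List.mem_of_head? hh)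
        exact this.1 rfl
      simp [h1, h2]
  · intro z hz
    have hz' : z ∈ p :: l₂ := List.mem_reverse.1 hz
    have := h.fst.left z (by simp at hz' ⊢; tauto)
    rw [List.head?_reverse]
    rwa [List.getLast?_append_of_ne_nil _ (by simp)] at this
  · intro z hz
    rw [List.getLast?_append_of_ne_nil _ (by simp)]
    rcases List.mem_append.1 hz with hz | hz
    · refine ⟨fun hh => h.left_notMem (hh ▸ hz), ?_⟩
      have h2 : (q :: m₂).getLast? ≠ some z := fun hh => by
        have := List.mem_of_getLast? hh
        exact (h.snd_adj z (by simp at this ⊢; tauto) z hz).1 rfl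
      simp [h2, hu z hz]
    · have := h.snd.left z (by simp at hz ⊢; tauto)
      rwa [List.getLast?_append_of_ne_nil _ (by simp)] at this

/-- The hole that runs from `v` along the beginning of the first hole to `p`, then along `R` and
the beginning of the second hole. -/
theorem isHole_right (h : Bridge G u v l₁ p l₂ m₁ q m₂ R) (hv : ∀ z ∈ R, ¬ G.Adj v z) :
    IsHole G v ((l₁ ++ [p]) ++ (R ++ q :: m₁.reverse)) := by
  have := h.symm.isHole hv
  simpa using this

/-- If `v` has no neighbor on `R` before `r`, then `u` does not see `r`: otherwise `u` would see
both `v` and `r` on a hole that leaves `v` along the first hole, follows `R` at least as far as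
`r`, and returns to `v` from the next neighbor of `v` on `R` or along the second hole. -/
theorem not_adj_of_first (hG : InC2 G) (h : Bridge G u v l₁ p l₂ m₁ q m₂ R) {R₁ R₂ : List V} {r : V}
    (hR : R = R₁ ++ r :: R₂) (hR₁ : ∀ z ∈ R₁, ¬ G.Adj v z) : ¬ G.Adj u r := by
  intro hur
  have huv := h.fst.adj
  have hvr : ¬ G.Adj v r := by
    intro hvr
    have hr : r ∈ R := by simp [hR]
    have : r ∉ u :: v :: (l₁ ++ p :: l₂) := by
      intro hh
      rcases List.mem_cons.1 hh with rfl | hh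
      · exact h.left_notMem hr
      rcases List.mem_cons.1 hh with rfl | hh
      · exact h.right_notMem hr
      · exact (h.fst_adj r hh r hr).1 rfl
    exact huv.ne (h.fst.eq_of_adj hG this (by simp) (by simp) hur.symm hvr.symm)
  have hul : u ∉ l₁ ++ p :: l₂ := fun hh => (h.fst.left u hh).1 rfl
  have hum : u ∉ m₁ ++ q :: m₂ := fun hh => (h.snd.left u hh).1 rfl
  have huR := h.left_notMem
  have hvR := h.right_notMem
  by_cases hv : ∃ z ∈ R₂, G.Adj v z
  · obtain ⟨R₃, s, R₄, rfl, hs, hR₃⟩ := exists_split_first (p := G.Adj v) hv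
    have hlp : IndPath G (l₁ ++ [p]) := by
      have := h.fst.path
      rw [← List.singleton_append, ← List.append_assoc] at this
      exact (IndPath.append_iff.1 this).1
    have hRp : IndPath G (R₁ ++ r :: (R₃ ++ [s])) := by
      have := h.path
      have e : R = (R₁ ++ r :: (R₃ ++ [s])) ++ R₄ := by simp [hR]
      rw [e] at this
      exact (IndPath.append_iff.1 this).1
    have hhead : (R₁ ++ r :: (R₃ ++ [s])).head? = R.head? := by
      rw [hR]; cases R₁ <;> simp
    have hlast : (R₁ ++ r :: (R₃ ++ [s])).getLast? = some s := by
      have : R₁ ++ r :: (R₃ ++ [s]) = (R₁ ++ r :: R₃) ++ [s] := by simp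
      rw [this]; exact List.getLast?_concat
    have hsub : ∀ z ∈ R₁ ++ r :: (R₃ ++ [s]), z ∈ R := by
      intro z hz; rw [hR]; simp at hz ⊢; tauto
    have hl : ∀ z, z ∈ l₁ ++ [p] → z ∈ l₁ ++ p :: l₂ := by
      intro z hz; simp at hz ⊢; tauto
    have hhole : IsHole G v ((l₁ ++ [p]) ++ (R₁ ++ r :: (R₃ ++ [s]))) := by
      refine IsHole.of_append hlp hRp (by simp) (by simp) ?_ ?_ ?_
      · intro x hx y hy
        have := h.fst_adj x (hl x hx) y (hsub y hy)
        rw [hhead, List.getLast?_concat]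
        grind
      · intro z hz
        have := h.fst.right z (hl z hz)
        have e : (l₁ ++ [p]).head? = (l₁ ++ p :: l₂).head? := by cases l₁ <;> simp
        rwa [e]
      · intro z hz
        refine ⟨fun hh => hvR (hh ▸ hsub z hz), ?_⟩
        rw [hlast]
        have hn := hRp.nodup
        grind
    have : v = r := hhole.eq_of_adj hG (y := u) (by
      have := huv.ne
      intro hh
      rcases List.mem_cons.1 hh with hh | hh
      · exact this hh
      rcases List.mem_append.1 hh with hh | hh
      · exact hul (hl u hh)
      · exact huR (hsub u hh)) (by simp) (by simp) huv hur
    exact hvR (by simp [this, hR])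
  · push Not at hv
    have hhole := h.isHole_right (fun z hz => by
      rw [hR] at hz
      rcases List.mem_append.1 hz with hz | hz
      · exact hR₁ z hz
      rcases List.mem_cons.1 hz with rfl | hz
      · exact hvr
      · exact hv z hz)
    have : v = r := hhole.eq_of_adj hG (y := u) (by
      have := huv.ne
      simp at hul hum ⊢
      tauto) (by simp) (by simp [hR]) huv hur
    exact hvR (by simp [this, hR])

theorem not_adj (hG : InC2 G) (h : Bridge G u v l₁ p l₂ m₁ q m₂ R) :
    ∀ z ∈ R, ¬ G.Adj u z ∧ ¬ G.Adj v z := by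
  by_contra hcon
  have hcon : ∃ z ∈ R, G.Adj u z ∨ G.Adj v z := by
    push Not at hcon
    obtain ⟨z, hz, hh⟩ := hcon
    exact ⟨z, hz, by tauto⟩
  obtain ⟨R₁, r, R₂, hR, hr, hR₁⟩ := exists_split_first hcon
  rcases hr with hr | hr
  · exact h.not_adj_of_first hG hR (fun z hz hh => hR₁ z hz (Or.inr hh)) hr
  · exact h.symm.not_adj_of_first hG hR (fun z hz hh => hR₁ z hz (Or.inl hh)) hr

/-- Otherwise `u` would see both `v` and `p` on the hole through the beginnings of both holes. -/
theorem not_adj_fst (hG : InC2 G) (h : Bridge G u v l₁ p l₂ m₁ q m₂ R) : ¬ G.Adj u p := by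
  intro hup
  have hul : u ∉ l₁ ++ p :: l₂ := fun hh => (h.fst.left u hh).1 rfl
  have hum : u ∉ m₁ ++ q :: m₂ := fun hh => (h.snd.left u hh).1 rfl
  have huR := h.left_notMem
  have := (h.isHole_right fun z hz => (h.not_adj hG z hz).2).eq_of_adj hG (y := u) (by
      have := h.fst.adj.ne
      simp at hul hum ⊢
      tauto) (by simp) (by simp) h.fst.adj hup
  exact (h.fst.right p (by simp)).1 this

theorem not_adj_snd (hG : InC2 G) (h : Bridge G u v l₁ p l₂ m₁ q m₂ R) : ¬ G.Adj v q := by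
  intro hup
  have hul : v ∉ l₁ ++ p :: l₂ := fun hh => (h.fst.right v hh).1 rfl
  have hum : v ∉ m₁ ++ q :: m₂ := fun hh => (h.snd.right v hh).1 rfl
  have huR := h.right_notMem
  have := (h.isHole fun z hz => (h.not_adj hG z hz).1).eq_of_adj hG (y := v) (by
      have := h.fst.adj.ne
      simp at hul hum ⊢
      tauto) (by simp) (by simp) h.fst.adj.symm hup
  exact (h.snd.left q (by simp)).1 this

/-- The hole that runs through `u v`, the beginning of the first hole, `R` and the end of the
second hole. -/
theorem isHole_cross (hG : InC2 G) (h : Bridge G u v l₁ p l₂ m₁ q m₂ R) :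
    IsHole G u (v :: ((l₁ ++ [p]) ++ (R ++ q :: m₂))) := by
  have hup := h.not_adj_fst hG
  have hvq := h.not_adj_snd hG
  have hn := h.not_adj hG
  have hvl : ∀ z ∈ l₁ ++ [p], v ≠ z ∧ (G.Adj v z ↔ (l₁ ++ [p]).head? = some z) := by
    intro z hz
    have := h.fst.right z (by simp at hz ⊢; tauto)
    have e : (l₁ ++ [p]).head? = (l₁ ++ p :: l₂).head? := by cases l₁ <;> simp
    rwa [e]
  have hlp : IndPath G (v :: (l₁ ++ [p])) := by
    refine ⟨?_, hvl⟩
    have := h.fst.path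
    rw [← List.singleton_append, ← List.append_assoc] at this
    exact (IndPath.append_iff.1 this).1
  have hlast : (v :: (l₁ ++ [p])).getLast? = some p := by
    rw [← List.cons_append]; exact List.getLast?_concat
  have := IsHole.of_append (x := u) hlp h.indPath_right (by simp) (by simp) ?_ ?_ ?_
  · simpa using this
  · intro x hx y hy
    rw [h.head?_eq_some_iff, hlast]
    rcases List.mem_cons.1 hx with rfl | hx
    · have hpx : p ≠ x := fun hh => (h.fst.right p (by simp)).1 hh.symm
      rcases List.mem_append.1 hy with hy | hy
      · exact ⟨fun hh => h.right_notMem (hh ▸ hy), by simp [(hn y hy).2, hpx]⟩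
      · have h1 := h.snd.right y (by simp at hy ⊢; tauto)
        refine ⟨h1.1, ?_⟩
        have : ¬ G.Adj x y := by
          rw [h1.2]
          have h2 := h.snd.right q (by simp)
          rcases m₁ with _ | ⟨a, m₁⟩
          · exact absurd (h2.2.2 (by simp)) hvq
          · intro hh
            obtain rfl : a = y := by simpa using hh
            have := h.snd.path.nodup
            grind
        simp [this, hpx]
    · rcases List.mem_append.1 hy with hy | hy
      · have := h.fst_adj x (by simp at hx ⊢; tauto) y hy
        grind
      · have h1 := h.anti x (by simp at hx ⊢; tauto) y (by simp at hy ⊢; tauto)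
        have h2 : R.head? ≠ some y := fun hh => by
          have := h.snd_adj y (by simp at hy ⊢; tauto) y (List.mem_of_head? hh)
          exact this.1 rfl
        simp [h1, h2]
  · intro z hz
    rcases List.mem_cons.1 hz with rfl | hz
    · exact ⟨h.fst.adj.ne, by simp [h.fst.adj]⟩
    · have h1 := h.fst.left z (by simp at hz ⊢; tauto)
      have h2 := hvl z hz
      refine ⟨h1.1, ?_⟩
      have : ¬ G.Adj u z := by
        rw [h1.2]
        have h3 := h.fst.left p (by simp)
        rcases l₂.eq_nil_or_concat with rfl | ⟨l₂, a, rfl⟩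
        · exact absurd (h3.2.2 (by simp)) hup
        · intro hh
          rw [List.concat_eq_append, ← List.cons_append, ← List.append_assoc,
            List.getLast?_concat] at hh
          have := h.fst.path.nodup
          grind
      simp [this, h2.1]
  · intro z hz
    rw [List.getLast?_append_of_ne_nil _ (by simp)]
    rcases List.mem_append.1 hz with hz | hz
    · refine ⟨fun hh => h.left_notMem (hh ▸ hz), ?_⟩
      have h2 : (q :: m₂).getLast? ≠ some z := fun hh => by
        have := List.mem_of_getLast? hh
        exact (h.snd_adj z (by simp at this ⊢; tauto) z hz).1 rfl
      simp [h2, (hn z hz).1]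
    · have := h.snd.left z (by simp at hz ⊢; tauto)
      rwa [List.getLast?_append_of_ne_nil _ (by simp)] at this

end Bridge

/-! ### Holes in graphs without clique cutsets of size at most two -/

/-- Two holes with a common edge `u v` that are otherwise disjoint and anticomplete: if `{u, v}`
does not separate them, then any node of the first lies on a common hole with `u` and the neighbor
of `u` on the second one. -/
theorem exists_hole_of_two_holes (hG : InC2 G) {W : Set V} {u v a y : V} {l m : List V}
    (hA : EdgeHole G u v l) (hB : EdgeHole G u v m)
    (hlm : ∀ x ∈ l, ∀ y ∈ m, x ≠ y ∧ ¬ G.Adj x y)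
    (hAW : ∀ z ∈ u :: v :: l, z ∈ W) (hBW : ∀ z ∈ m, z ∈ W)
    (hconn : ∃ x ∈ l, ∃ y ∈ m, Reach G (W \ {u, v}) x y) (ha : a ∈ l)
    (hy : m.getLast? = some y) :
    ∃ k, IsHole G u k ∧ a ∈ k ∧ y ∈ k ∧ ∀ z ∈ u :: k, z ∈ W := by
  obtain ⟨p, hp, q, hq, R, hRne, hR, hRW, hRl, hRm⟩ :=
    exists_shortest_link (L := {x | x ∈ l}) (M := {x | x ∈ m}) hlm hconn
  simp only [Set.mem_ofPred_eq] at hp hq hRW hRl hRm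
  have hRW' : ∀ z ∈ R, z ∈ W ∧ z ≠ u ∧ z ≠ v ∧ z ∉ l ∧ z ∉ m := fun z hz => by
    have := hRW z hz
    simp only [Set.mem_sdiff, Set.mem_insert_iff, Set.mem_singleton_iff] at this
    tauto
  have hpR : ∀ z ∈ R, p ≠ z ∧ (G.Adj p z ↔ R.head? = some z) := fun z hz => by
    have := hR.2 z (by simp [hz])
    rwa [List.head?_append_of_ne_nil _ hRne] at this
  have hqR : ∀ z ∈ R, q ≠ z ∧ (G.Adj q z ↔ R.getLast? = some z) := fun z hz => by
    have := (IndPath.append_iff.1 hR.1).2.2 z hz q (by simp)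
    rw [G.adj_comm]
    exact ⟨this.1.symm, by simpa using this.2⟩
  obtain ⟨l₁, l₂, rfl⟩ := List.append_of_mem hp
  obtain ⟨m₁, m₂, rfl⟩ := List.append_of_mem hq
  have hBr : Bridge G u v l₁ p l₂ m₁ q m₂ R := by
    refine ⟨hA, hB, hlm, (IndPath.append_iff.1 hR.1).1, hRne, fun h => (hRW' u h).2.1 rfl,
      fun h => (hRW' v h).2.2.1 rfl, ?_, ?_⟩
    · intro x hx z hz
      have h1 := hRW' z hz
      refine ⟨fun hh => h1.2.2.2.1 (hh ▸ hx), fun hh => ?_, ?_⟩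
      · have h2 := hRl x hx z hz hh
        refine ⟨?_, h2⟩
        refine hA.eq_of_adj hG (y := z) ?_ (by simp at hx ⊢; tauto) (by simp) hh.symm
          ((hpR z hz).2.2 h2).symm
        simp only [List.mem_cons]
        tauto
      · rintro ⟨rfl, h2⟩
        exact (hpR z hz).2.2 h2
    · intro x hx z hz
      have h1 := hRW' z hz
      refine ⟨fun hh => h1.2.2.2.2 (hh ▸ hx), fun hh => ?_, ?_⟩
      · have h2 := hRm x hx z hz hh
        refine ⟨?_, h2⟩
        refine hB.eq_of_adj hG (y := z) ?_ (by simp at hx ⊢; tauto) (by simp) hh.symm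
          ((hqR z hz).2.2 h2).symm
        simp only [List.mem_cons]
        tauto
      · rintro ⟨rfl, h2⟩
        exact (hqR z hz).2.2 h2
  have hy' : y ∈ q :: m₂ := by
    rw [List.getLast?_append_of_ne_nil _ (by simp)] at hy
    exact List.mem_of_getLast? hy
  by_cases hal : a ∈ p :: l₂
  · refine ⟨_, hBr.isHole fun z hz => (hBr.not_adj hG z hz).1, ?_, ?_, ?_⟩
    · simp at hal ⊢; tauto
    · simp at hy' ⊢; tauto
    · grind
  · refine ⟨_, hBr.isHole_cross hG, ?_, ?_, ?_⟩
    · simp at hal ha ⊢; tauto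
    · simp at hy' ⊢; tauto
    · grind

/-- No set of one node or of two adjacent nodes separates two nodes of `W` inside `W`. -/
def Atom (G : SimpleGraph V) (W : Set V) : Prop :=
  ∀ z q, (z = q ∨ G.Adj z q) → ∀ a ∈ W \ {z, q}, ∀ b ∈ W \ {z, q}, Reach G (W \ {z, q}) a b

/-- If `z` lies on a hole with `a`, then any neighbor `y` of `z` lies on a hole with both. The
induction is on the length of a path `R` that starts at `y`, avoids the hole and contains a
neighbor of it: the last neighbor of `z` on `R` can be put on a hole with `a` and `z`, which
shortens `R`. -/
theorem Atom.exists_hole_adj (hG : InC2 G) {W : Set V} (hW : Atom G W) {a z y : V} (hzy : G.Adj z y)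
    (n : ℕ) : ∀ (m R : List V), R.length = n → IsHole G z m → (∀ w ∈ z :: m, w ∈ W) →
      a ∈ z :: m → IndPath G R → R.head? = some y → (∀ w ∈ R, w ∈ W ∧ w ∉ z :: m) →
      (∃ w ∈ R, ∃ q ∈ m, G.Adj w q) →
      ∃ m', IsHole G z m' ∧ (∀ w ∈ z :: m', w ∈ W) ∧ a ∈ z :: m' ∧ y ∈ m' := by
  induction n using Nat.strong_induction_on with
  | _ n ih =>
  rintro m R hn hm hmW ha hR hRy hRW hRm
  -- cut `R` at the first node that sees the hole outside `z`
  obtain ⟨R₁, w, R₂, hRe, ⟨q, hq, hwq⟩, hR₁⟩ := exists_split_first hRm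
  have hR' : IndPath G (R₁ ++ [w]) := by
    have e : R = (R₁ ++ [w]) ++ R₂ := by simp [hRe]
    rw [e] at hR
    exact (IndPath.append_iff.1 hR).1
  have hRy' : (R₁ ++ [w]).head? = some y := by
    rw [← hRy, hRe]; cases R₁ <;> simp
  have hRW' : ∀ x ∈ R₁ ++ [w], x ∈ W ∧ x ∉ z :: m := by
    intro x hx
    exact hRW x (by simp [hRe] at hx ⊢; tauto)
  have hlen : (R₁ ++ [w]).length ≤ n := by rw [← hn, hRe]; simp
  have hzw : ¬ G.Adj z w := by
    intro h
    have := hm.eq_of_adj hG (hRW' w (by simp)).2 (by simp) (by simp [hq]) h.symm hwq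
    exact hm.notMem (this ▸ hq)
  clear hRe hRm hRW hRy hR R₂
  -- the last neighbor `r` of `z` on `R`
  obtain ⟨S₁, r, S₂, hS, hr, hS₂⟩ := exists_split_last (l := R₁ ++ [w]) (p := G.Adj z)
    ⟨y, List.mem_of_head? hRy', hzy⟩
  have hS₂e : ∃ S₃, S₂ = S₃ ++ [w] ∧ R₁ = S₁ ++ r :: S₃ := by
    rcases S₂.eq_nil_or_concat with rfl | ⟨S₃, x, rfl⟩
    · have : w = r := by
        have := congrArg List.getLast? hS
        simpa using this
      exact absurd hr (this ▸ hzw)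
    · have e : R₁ ++ [w] = (S₁ ++ r :: S₃) ++ [x] := by simpa using hS
      have := List.append_inj' e rfl
      exact ⟨S₃, by simp_all, this.1⟩
  obtain ⟨S₃, rfl, rfl⟩ := hS₂e
  -- the part of `R` after `r`
  have hT : IndPath G (r :: (S₃ ++ [w])) := by
    rw [hS] at hR'
    exact (IndPath.append_iff.1 hR').2.1
  have hTlast : (r :: (S₃ ++ [w])).getLast? = some w := by
    rw [← List.cons_append]; exact List.getLast?_concat
  have hzT : ∀ x ∈ r :: (S₃ ++ [w]), z ≠ x ∧ (G.Adj z x ↔ (r :: (S₃ ++ [w])).head? = some x) := by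
    intro x hx
    refine ⟨fun hh => (hRW' x (by rw [hS]; simp at hx ⊢; tauto)).2 (by simp [hh]), ?_⟩
    have := hT.nodup
    grind
  have hTm : ∀ x ∈ r :: (S₃ ++ [w]), ∀ x' ∈ m, x ≠ x' ∧ (G.Adj x x' ↔
      (r :: (S₃ ++ [w])).getLast? = some x ∧ q = x') := by
    intro x hx x' hx'
    have h1 := hRW' x (by rw [hS]; simp at hx ⊢; tauto)
    refine ⟨fun hh => h1.2 (by simp [hh, hx']), fun hh => ?_, ?_⟩
    · rw [hTlast]
      have hxw : x = w := by
        by_contra hne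
        exact hR₁ x (by simp at hx ⊢; tauto) ⟨x', hx', hh⟩
      subst hxw
      exact ⟨rfl, hm.eq_of_adj hG h1.2 (by simp [hq]) (by simp [hx']) hwq hh⟩
    · rw [hTlast]
      rintro ⟨h2, rfl⟩
      obtain rfl : w = x := by simpa using h2
      exact hwq
  have key : ∃ m', IsHole G z m' ∧ (∀ w ∈ z :: m', w ∈ W) ∧ a ∈ z :: m' ∧ r ∈ m' := by
    by_cases hzq : G.Adj z q
    · -- the two holes share the edge `z q`
      obtain ⟨m₀, hm₀, hm₀m⟩ := hm.exists_edge (by simp) (by simp [hq]) hzq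
      have hA := isHole_cons_iff.1 hm₀
      have hB : EdgeHole G z q (r :: (S₃ ++ [w])).reverse := by
        refine ⟨hzq, hT.reverse, by simp, ?_, ?_⟩
        · intro x hx
          rw [List.getLast?_reverse]
          exact hzT x (List.mem_reverse.1 hx)
        · intro x hx
          have h1 := hTm x (List.mem_reverse.1 hx) q hq
          have h2 := G.adj_comm x q
          rw [List.head?_reverse]
          grind
      have hTW : ∀ x ∈ (r :: (S₃ ++ [w])).reverse, x ∈ W := by
        intro x hx
        have hx := List.mem_reverse.1 hx
        exact (hRW' x (by rw [hS]; simp at hx ⊢; tauto)).1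
      have hanti : ∀ x ∈ m₀, ∀ x' ∈ (r :: (S₃ ++ [w])).reverse, x ≠ x' ∧ ¬ G.Adj x x' := by
        intro x hx x' hx'
        have hxm : x ∈ m := by
          rcases List.mem_cons.1 ((hm₀m x).1 (by simp [hx])) with rfl | h
          · exact absurd rfl (hA.left x hx).1
          · exact h
        have h1 := hTm x' (List.mem_reverse.1 hx') x hxm
        have h2 := (hA.right x hx).1
        have h3 := G.adj_comm x x'
        grind
      have hW₀ : ∀ x ∈ z :: q :: m₀, x ∈ W := fun x hx => hmW x ((hm₀m x).1 hx)
      by_cases ham₀ : a ∈ m₀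
      · obtain ⟨k, hk, hak, hrk, hkW⟩ := exists_hole_of_two_holes hG (W := W) (y := r) hA hB hanti
          hW₀ hTW (by
            refine ⟨a, ham₀, w, by simp, hW z q (Or.inr hzq) a ?_ w ?_⟩
            · have h1 := hA.left a ham₀
              have h2 := hA.right a ham₀
              exact ⟨hW₀ a (by simp [ham₀]), by simp [h1.1.symm, h2.1.symm]⟩
            · have h1 := hB.left w (by simp)
              have h2 := hB.right w (by simp)
              exact ⟨hTW w (by simp), by simp [h1.1.symm, h2.1.symm]⟩) ham₀
              (by rw [List.getLast?_reverse]; rfl)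
        exact ⟨k, hk, hkW, by simp [hak], hrk⟩
      · refine ⟨_, isHole_cons_iff.2 hB, ?_, ?_, by simp⟩
        · intro x hx
          rcases List.mem_cons.1 hx with rfl | hx
          · exact hmW _ (by simp)
          rcases List.mem_cons.1 hx with rfl | hx
          · exact hmW _ (by simp [hq])
          · exact hTW x hx
        · have := (hm₀m a).2 ha
          simp at this ⊢
          tauto
    · -- one of the two arcs of the hole between `z` and `q` contains `a`
      have arc : ∀ l₁ l₂, IsHole G z (l₁ ++ q :: l₂) → (∀ x, x ∈ l₁ ++ q :: l₂ ↔ x ∈ m) →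
          IsHole G z ((r :: (S₃ ++ [w])) ++ q :: l₂) := by
        intro l₁ l₂ hl hlm
        refine IsHole.of_append hT (IndPath.append_iff.1 hl.path).2.1 (by simp) (by simp) ?_ hzT ?_
        · intro x hx x' hx'
          have := hTm x hx x' ((hlm x').1 (by simp at hx' ⊢; tauto))
          simpa using this
        · intro x hx
          have h1 := hl.adj x (by simp at hx ⊢; tauto)
          have h2 := hl.notMem
          have h3 : (l₁ ++ q :: l₂).head? ≠ some x := by
            have h4 := (hl.adj q (by simp)).not.1 hzq
            have h5 := hl.path.nodup
            rcases l₁ with _ | ⟨b, l₁⟩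
            · simp at h4
            · grind
          rw [List.getLast?_append_of_ne_nil _ (by simp)] at h1
          refine ⟨fun hh => h2 (hh ▸ (by simp at hx ⊢; tauto)), ?_⟩
          rw [h1]
          tauto
      have arc' : ∀ l₁ l₂, IsHole G z (l₁ ++ q :: l₂) → (∀ x, x ∈ l₁ ++ q :: l₂ ↔ x ∈ m) →
          a ∈ z :: q :: l₂ →
          ∃ m', IsHole G z m' ∧ (∀ w ∈ z :: m', w ∈ W) ∧ a ∈ z :: m' ∧ r ∈ m' := by
        intro l₁ l₂ hl hlm hal
        refine ⟨_, arc l₁ l₂ hl hlm, ?_, by simp at hal ⊢; tauto, by simp⟩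
        intro x hx
        rcases List.mem_cons.1 hx with rfl | hx
        · exact hmW _ (by simp)
        rcases List.mem_append.1 hx with hx | hx
        · exact (hRW' x (by rw [hS]; simp at hx ⊢; tauto)).1
        · exact hmW x (by
            have := (hlm x).1 (by simp at hx ⊢; tauto)
            simp [this])
      obtain ⟨l₁, l₂, rfl⟩ := List.append_of_mem hq
      by_cases hal : a ∈ z :: q :: l₂
      · exact arc' l₁ l₂ hm (fun _ => Iff.rfl) hal
      · refine arc' l₂.reverse l₁.reverse (by simpa using hm.reverse) ?_ ?_
        · intro x
          simp
          tauto
        · simp at ha hal ⊢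
          tauto
  obtain ⟨m', hm', hm'W, ham', hrm'⟩ := key
  by_cases hym : y ∈ m'
  · exact ⟨m', hm', hm'W, ham', hym⟩
  rw [hS] at hR'
  -- the nodes of `R` before the new hole
  have hSm : ∃ S f S', S₁ ++ [r] = S ++ f :: S' ∧ f ∈ m' ∧ ∀ x ∈ S, x ∉ m' :=
    exists_split_first ⟨r, by simp, hrm'⟩
  obtain ⟨S, f, S', hSf, hf, hSm⟩ := hSm
  have e : S₁ ++ r :: (S₃ ++ [w]) = S ++ (f :: (S' ++ (S₃ ++ [w]))) := by
    have : S₁ ++ r :: (S₃ ++ [w]) = (S₁ ++ [r]) ++ (S₃ ++ [w]) := by simp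
    rw [this, hSf]
    simp
  rw [e] at hR'
  rw [hS, e] at hRy' hRW' hlen
  rcases S.eq_nil_or_concat with rfl | ⟨S₀, x, rfl⟩
  · obtain rfl : f = y := by simpa using hRy'
    exact absurd hf hym
  refine ih (S₀.concat x).length ?_ m' _ rfl hm' hm'W ham' (IndPath.append_iff.1 hR').1 ?_ ?_ ?_
  · simp at hlen ⊢
    omega
  · rw [← hRy']
    cases S₀ <;> simp
  · intro x' hx'
    have h1 := hRW' x' (by simp at hx' ⊢; tauto)
    refine ⟨h1.1, fun hh => ?_⟩
    rcases List.mem_cons.1 hh with rfl | hh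
    · exact h1.2 (by simp)
    · exact hSm x' hx' hh
  · exact ⟨x, by simp, f, hf,
      ((IndPath.append_iff.1 hR').2.2 x (by simp) f (by simp)).2.2 (by simp)⟩

/-! ### Separating two neighbors of a node -/

theorem Reach.exists_adj {A : Set V} {a b : V} (h : Reach G A a b) (hab : a ≠ b) :
    ∃ c, G.Adj a c ∧ Reach G A c b := by
  rcases Relation.ReflTransGen.cases_head h.2 with rfl | ⟨c, hc, hcb⟩
  · exact absurd rfl hab
  · exact ⟨c, hc.1, hc.2, hcb⟩

/-- A node that can reach some nonadjacent node of an atom lies on a hole: no node is a cutset, so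
two of its neighbors are joined by a path that avoids it. -/
theorem Atom.exists_hole_self {W : Set V} (hW : Atom G W) {a b : V} (hr : Reach G W a b)
    (hab : a ≠ b) (hnab : ¬ G.Adj a b) :
    ∃ m, IsHole G a m ∧ ∀ w ∈ a :: m, w ∈ W := by
  obtain ⟨c, hac, hcb⟩ := hr.exists_adj hab
  have hcne : b ≠ c := fun h => hnab (h ▸ hac)
  obtain ⟨d, had, hdb⟩ := (hW c c (Or.inl rfl) a ⟨hr.1, by simp [hac.ne]⟩ b
    ⟨hr.mem_right, by simp [hcne]⟩).exists_adj hab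
  have hd := hdb.1
  obtain ⟨l, hl, hlW⟩ := (hW a a (Or.inl rfl) c ⟨hcb.1, by simp [hac.ne']⟩ d
    ⟨hd.1, by simp [had.ne']⟩).exists_indPath_cons (fun h => hd.2 (by simp [h]))
  obtain ⟨l₁, f, l₂, hlf, hf, hl₁⟩ := exists_split_first (l := l ++ [d]) (p := G.Adj a)
    ⟨d, by simp, had⟩
  have e : c :: (l ++ [d]) = (c :: (l₁ ++ [f])) ++ l₂ := by simp [hlf]
  rw [e] at hl hlW
  have hp := (IndPath.append_iff.1 hl).1
  have hp' : IndPath G ([c] ++ (l₁ ++ [f])) := hp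
  rw [IndPath.append_iff] at hp'
  have hn := hp.nodup
  have hmem : ∀ x ∈ c :: (l₁ ++ [f]), x ∈ W ∧ a ≠ x := fun x hx => by
    have h := hlW x (List.mem_append_left _ hx)
    exact ⟨h.1, fun hh => h.2 (by simp [hh])⟩
  refine ⟨[c] ++ (l₁ ++ [f]), IsHole.of_append hp'.1 hp'.2.1 (by simp) (by simp) hp'.2.2
    (by simpa [hac] using hac.ne) ?_, ?_⟩
  · intro z hz
    refine ⟨(hmem z (by simp at hz ⊢; tauto)).2, ?_⟩
    rw [List.getLast?_concat]
    grind
  · intro x hx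
    rcases List.mem_cons.1 hx with rfl | hx
    · exact hr.1
    · exact (hmem x hx).1

/-- Any two distinct nonadjacent nodes of a connected atom lie on a common hole. -/
theorem Atom.exists_hole (hG : InC2 G) {W : Set V} (hW : Atom G W) {a b : V} (hr : Reach G W a b)
    (hab : a ≠ b) (hnab : ¬ G.Adj a b) :
    ∃ m, IsHole G b m ∧ (∀ w ∈ b :: m, w ∈ W) ∧ a ∈ b :: m := by
  obtain ⟨m₀, hm₀, hm₀W⟩ := hW.exists_hole_self hr hab hnab
  obtain ⟨haW, hr⟩ := hr
  clear hab hnab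
  induction hr with
  | refl => exact ⟨m₀, hm₀, hm₀W, by simp⟩
  | @tail z y hz hzy ih =>
    obtain ⟨m, hm, hmW, ham⟩ := ih
    suffices h : ∃ m', IsHole G z m' ∧ (∀ w ∈ z :: m', w ∈ W) ∧ a ∈ z :: m' ∧ y ∈ m' by
      obtain ⟨m', hm', hm'W, ham', hym'⟩ := h
      obtain ⟨k, hk, hkm⟩ := hm'.exists_base (y := y) (by simp [hym'])
      exact ⟨k, hk, fun w hw => hm'W w ((hkm w).1 hw), (hkm a).2 ham'⟩
    by_cases hym : y ∈ m
    · exact ⟨m, hm, hmW, ham, hym⟩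
    obtain ⟨q, hq⟩ : ∃ q, q ∈ m := by
      have := hm.two_le
      exact List.exists_mem_of_length_pos (by omega)
    have hzq : q ≠ z := fun h => hm.notMem (h ▸ hq)
    obtain ⟨l, hl, hlW⟩ := (hW z z (Or.inl rfl) y ⟨hzy.2, by simp [hzy.1.ne']⟩ q
      ⟨hmW q (by simp [hq]), by simp [hzq]⟩).exists_indPath_cons (fun h => hym (h ▸ hq))
    obtain ⟨R, f, l₂, hlf, hf, hR⟩ := exists_split_first (l := y :: (l ++ [q])) (p := (· ∈ m))
      ⟨q, by simp, hq⟩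
    rw [hlf] at hl hlW
    have hl' := IndPath.append_iff.1 hl
    rcases R.eq_nil_or_concat with rfl | ⟨R, x, rfl⟩
    · obtain ⟨rfl, -⟩ : y = f ∧ _ := by simpa using hlf
      exact absurd hf hym
    refine hW.exists_hole_adj hG hzy.1 _ m (R.concat x) rfl hm hmW ham hl'.1 ?_ ?_ ?_
    · have := congrArg List.head? hlf
      rw [List.head?_append_of_ne_nil _ (by simp)] at this
      simpa using this.symm
    · intro w hw
      have h := hlW w (List.mem_append_left _ hw)
      refine ⟨h.1, fun hh => ?_⟩
      rcases List.mem_cons.1 hh with rfl | hh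
      · exact h.2 (by simp)
      · exact hR w hw hh
    · exact ⟨x, by simp, f, hf, (hl'.2.2 x (by simp) f (by simp)).2.2 (by simp)⟩

/-- If `G[W]` is decomposed along the clique `{c, d}`, nodes `a` and `b` on the same side that are
not separated by `X` are not separated by `X` within this side either. -/
theorem reach_side {W : Set V} {a b c d : V} (hcd : c = d ∨ G.Adj c d) (ha : a ∉ ({c, d} : Set V))
    (hb : b ∈ ({c, d} : Set V) ∨ Reach G (W \ {c, d}) a b) {X : Set V}
    (h : Reach G (W \ X) a b) :
    Reach G ((W ∩ {g | g ∈ ({c, d} : Set V) ∨ Reach G (W \ {c, d}) a g}) \ X) a b := by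
  set D := {g | g ∈ ({c, d} : Set V) ∨ Reach G (W \ {c, d}) a g} with hD
  have haD : a ∈ D := Or.inr (Reach.refl ⟨h.1.1, ha⟩)
  have key : ∀ g, Reach G (W \ X) a g → (g ∈ D → Reach G ((W ∩ D) \ X) a g) ∧
      (g ∉ D → ∃ k ∈ ({c, d} : Set V), Reach G ((W ∩ D) \ X) a k) := by
    rintro g ⟨h1, h2⟩
    induction h2 with
    | refl => exact ⟨fun h => Reach.refl ⟨⟨h1.1, h⟩, h1.2⟩, fun h => absurd haD h⟩
    | @tail g g' hg hgg' ih =>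
      have hgW : g ∈ W \ X := Reach.mem_right ⟨h1, hg⟩
      by_cases hgD : g ∈ D
      · refine ⟨fun h => (ih.1 hgD).tail hgg'.1 ⟨⟨hgg'.2.1, h⟩, hgg'.2.2⟩, fun h => ?_⟩
        refine ⟨g, ?_, ih.1 hgD⟩
        rcases hgD with hgD | hgD
        · exact hgD
        · exact absurd (Or.inr (hgD.tail hgg'.1 ⟨hgg'.2.1, fun hh => h (Or.inl hh)⟩)) h
      · obtain ⟨k, hk, hak⟩ := ih.2 hgD
        refine ⟨fun h => ?_, fun _ => ⟨k, hk, hak⟩⟩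
        have hg'cd : g' ∈ ({c, d} : Set V) := by
          rcases h with h | h
          · exact h
          · exact absurd (Or.inr (h.tail hgg'.1.symm ⟨hgW.1, fun hh => hgD (Or.inl hh)⟩)) hgD
        by_cases hkg : k = g'
        · exact hkg ▸ hak
        · refine hak.tail ?_ ⟨⟨hgg'.2.1, h⟩, hgg'.2.2⟩
          rcases hcd with rfl | hcd
          · simp at hk hg'cd
            exact absurd (hk.trans hg'cd.symm) hkg
          · simp at hk hg'cd
            rcases hk with rfl | rfl <;> rcases hg'cd with rfl | rfl
            · exact absurd rfl hkg
            · exact hcd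
            · exact hcd.symm
            · exact absurd rfl hkg
  exact (key b h).1 hb

/-- Two nonadjacent neighbors `a` and `b` of a node `x` are separated by `x` alone or together with
a clique of size at most two. Otherwise an inclusionwise minimal set of nodes other than `x` in
which no such clique separates `a` from `b` would be an atom, thus contain a hole through `a` and
`b`, and `x` would be the center of a propeller. -/
theorem exists_clique_separator [Finite V] (hG : InC2 G) {x a b : V} (hxa : G.Adj x a)
    (hxb : G.Adj x b) (hab : a ≠ b) (hnab : ¬ G.Adj a b) :
    ¬ Reach G {x}ᶜ a b ∨ ∃ c d, (c = d ∨ G.Adj c d) ∧ a ∉ ({c, d} : Set V) ∧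
      b ∉ ({c, d} : Set V) ∧ ¬ Reach G ({x}ᶜ \ {c, d}) a b := by
  by_contra hcon
  push Not at hcon
  obtain ⟨hr, hcon⟩ := hcon
  let P : Set V → Prop := fun W => x ∉ W ∧ Reach G W a b ∧
    ∀ c d, (c = d ∨ G.Adj c d) → a ∉ ({c, d} : Set V) → b ∉ ({c, d} : Set V) →
      Reach G (W \ {c, d}) a b
  have hP : P {x}ᶜ := ⟨by simp, hr, hcon⟩
  obtain ⟨W, hWle, hWmin⟩ := Set.Finite.exists_le_minimal (Set.toFinite {W | P W}) hP
  obtain ⟨hxW, hrW, hW⟩ := hWmin.prop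
  have hatom : Atom G W := by
    intro c d hcd e he f hf
    have hacd : a ∉ ({c, d} : Set V) ∨ b ∉ ({c, d} : Set V) := by
      by_contra hh
      push Not at hh
      simp only [Set.mem_insert_iff, Set.mem_singleton_iff] at hh
      have := G.adj_comm a b
      grind
    have main : ∀ a' b', (∀ X, Reach G (W \ X) a b ↔ Reach G (W \ X) a' b') →
        (∀ W', (∀ X, Reach G (W \ X) a' b' → Reach G (W' \ X) a' b') →
          ∀ X, Reach G (W \ X) a b → Reach G (W' \ X) a b) →
        (b' ∈ ({c, d} : Set V) ∨ Reach G (W \ {c, d}) a' b') →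
        a' ∉ ({c, d} : Set V) → Reach G (W \ {c, d}) e f := by
      intro a' b' hab' hW' hb' ha'
      set W' := W ∩ {g | g ∈ ({c, d} : Set V) ∨ Reach G (W \ {c, d}) a' g} with hW'def
      have h1 := hW' W' fun X hX => reach_side hcd ha' hb' hX
      have hPW : P W' := by
        refine ⟨fun h => hxW h.1, ?_, fun c' d' hcd' ha hb => h1 _ (hW c' d' hcd' ha hb)⟩
        have := h1 ∅
        simp only [Set.sdiff_empty] at this
        exact this hrW
      have h2 : W ⊆ W' := hWmin.le_of_le hPW Set.inter_subset_left
      have h3 : ∀ g ∈ W \ {c, d}, Reach G (W \ {c, d}) a' g := fun g hg =>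
        (h2 hg.1).2.resolve_left hg.2
      exact (h3 e he).symm.trans (h3 f hf)
    by_cases ha : a ∈ ({c, d} : Set V)
    · refine main b a (fun X => ⟨Reach.symm, Reach.symm⟩)
        (fun W' h X hX => (h X hX.symm).symm) (Or.inl ha) (hacd.resolve_left (not_not.2 ha))
    · refine main a b (fun X => Iff.rfl) (fun W' h X hX => h X hX) ?_ ha
      by_cases hb : b ∈ ({c, d} : Set V)
      · exact Or.inl hb
      · exact Or.inr (hW c d hcd ha hb)
  obtain ⟨m, hm, hmW, ham⟩ := hatom.exists_hole hG hrW hab hnab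
  exact hab (hm.eq_of_adj hG (fun h => hxW (hmW x h)) ham (by simp) hxa hxb)

/-! ### Components, triangles and attachments -/

theorem Reach.mem_of_closed {A D : Set V} {a b : V} (h : Reach G A a b) (ha : a ∈ D)
    (hD : ∀ g ∈ D, ∀ k ∈ A, G.Adj g k → k ∈ D) : b ∈ D := by
  obtain ⟨_, h⟩ := h
  induction h with
  | refl => exact ha
  | tail _ h ih => exact hD _ ih _ h.2 h.1

theorem Atom.reach (hA : Atom G Set.univ) {z q a b : V} (h : z = q ∨ G.Adj z q)
    (ha : a ∉ ({z, q} : Set V)) (hb : b ∉ ({z, q} : Set V)) : Reach G {z, q}ᶜ a b :=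
  (hA z q h a ⟨trivial, ha⟩ b ⟨trivial, hb⟩).mono fun _ hx => hx.2

/-- In an atom, a nonempty set that is left by edges only towards a clique of size at most two
contains every node outside this clique. -/
theorem Atom.mem_of_closed (hA : Atom G Set.univ) {z q d e : V} {D : Set V}
    (h : z = q ∨ G.Adj z q) (hz : z ∉ D) (hq : q ∉ D) (hd : d ∈ D) (he : e ≠ z) (he' : e ≠ q)
    (hD : ∀ g ∈ D, ∀ k, G.Adj g k → k ≠ z → k ≠ q → k ∈ D) : e ∈ D := by
  have hd' : d ∉ ({z, q} : Set V) := by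
    rintro (rfl | rfl)
    · exact hz hd
    · exact hq hd
  refine (hA.reach h hd' (b := e) (by simp [he, he'])).mem_of_closed hd fun g hg k hk hgk => ?_
  simp only [Set.mem_compl_iff, Set.mem_insert_iff, Set.mem_singleton_iff, not_or] at hk
  exact hD g hg k hgk hk.1 hk.2

/-- The node set of the component of `G ∖ X` that contains `a`. -/
def comp (G : SimpleGraph V) (X : Set V) (a : V) : Set V := {b | Reach G Xᶜ a b}

section comp

variable {X : Set V} {a b c : V}

theorem mem_comp_self (ha : a ∉ X) : a ∈ comp G X a := Reach.refl ha

theorem notMem_of_mem_comp (h : b ∈ comp G X a) : b ∉ X := Reach.mem_right h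

theorem mem_comp_of_adj (h : b ∈ comp G X a) (hbc : G.Adj b c) (hc : c ∉ X) : c ∈ comp G X a :=
  Reach.tail h hbc hc

theorem sConn_comp (X : Set V) (a : V) : SConn G (comp G X a) := by
  have key : ∀ b, Reach G Xᶜ a b → Reach G (comp G X a) a b := by
    rintro b ⟨ha, h⟩
    induction h with
    | refl => exact Reach.refl (Reach.refl ha)
    | @tail c d h1 h2 ih => exact ih.tail h2.1 (Reach.tail ⟨ha, h1⟩ h2.1 h2.2)
  exact fun b hb c hc => (key b hb).symm.trans (key c hc)

theorem comp_anticomplete (h : ¬ Reach G Xᶜ a b) :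
    ∀ x ∈ comp G X a, ∀ y ∈ comp G X b, x ≠ y ∧ ¬ G.Adj x y := by
  intro x hx y hy
  refine ⟨?_, fun hxy => ?_⟩
  · rintro rfl
    exact h (Reach.trans hx (Reach.symm hy))
  · exact h ((Reach.tail hx hxy (Reach.mem_right hy)).trans (Reach.symm hy))

end comp

theorem SConn.insert_of_adj {D : Set V} {v : V} (hD : SConn G D) (hv : ∃ d ∈ D, G.Adj v d) :
    SConn G (insert v D) := by
  obtain ⟨d, hd, hvd⟩ := hv
  have key : ∀ b ∈ insert v D, Reach G (insert v D) v b := by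
    rintro b (rfl | hb)
    · exact Reach.refl (by simp)
    · exact (Reach.of_adj (by simp) (by simp [hd]) hvd).trans
        ((hD d hd b hb).mono (Set.subset_insert _ _))
  exact fun b hb c hc => (key b hb).symm.trans (key c hc)

theorem IndPath.sConn {l : List V} (h : IndPath G l) : SConn G {z | z ∈ l} := by
  induction l with
  | nil => intro a ha; simp at ha
  | cons a l ih =>
    have e : {z | z ∈ a :: l} = insert a {z | z ∈ l} := by ext; simp
    rw [e]
    rcases l with _ | ⟨b, l⟩
    · intro x hx y hy
      obtain rfl : x = a := by simpa using hx
      obtain rfl : y = x := by simpa using hy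
      exact Reach.refl hx
    · exact (ih h.1).insert_of_adj ⟨b, by simp, (h.2 b (by simp)).2.2 rfl⟩

/-- If `s` and `t` are joined through two anticomplete connected sets, then any node `y` that sees
`s` has no neighbor on a suitable induced path through the first set: `s` is the only neighbor of
`y` on the hole formed by two such paths. -/
theorem exists_link_avoiding (hG : InC2 G) {s t y : V} {D₁ D₂ : Set V} (hst : ¬ G.Adj s t)
    (hne : s ≠ t) (h₁ : SConn G D₁) (h₂ : SConn G D₂) (hs₁ : ∃ d ∈ D₁, G.Adj s d)
    (ht₁ : ∃ d ∈ D₁, G.Adj t d) (hs₂ : ∃ d ∈ D₂, G.Adj s d) (ht₂ : ∃ d ∈ D₂, G.Adj t d)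
    (h : ∀ x ∈ D₁, ∀ z ∈ D₂, x ≠ z ∧ ¬ G.Adj x z) (hy₁ : y ∉ D₁) (hy₂ : y ∉ D₂)
    (hys : G.Adj y s) (hyt : y ≠ t) :
    ¬ G.Adj y t ∧ ∃ l, l ≠ [] ∧ IndPath G (s :: (l ++ [t])) ∧ (∀ z ∈ l, z ∈ D₁) ∧
      ∀ z ∈ l, ¬ G.Adj y z := by
  obtain ⟨l₁, hl₁, hp₁, hD₁⟩ := h₁.exists_link hst hne hs₁ ht₁
  obtain ⟨l₂, hl₂, hp₂, hD₂⟩ := h₂.exists_link hst hne hs₂ ht₂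
  have hole := IsHole.of_links hp₁ hp₂ hl₁ hl₂ fun x hx z hz => h x (hD₁ x hx) z (hD₂ z hz)
  have hy : y ∉ s :: (l₁ ++ t :: l₂.reverse) := by
    have h1 : y ∉ l₁ := fun hh => hy₁ (hD₁ y hh)
    have h2 : y ∉ l₂ := fun hh => hy₂ (hD₂ y hh)
    have := hys.ne
    simp
    tauto
  have hn₁ := hp₁.nodup
  refine ⟨fun hyt' => hne (hole.eq_of_adj hG hy (by simp) (by simp) hys hyt'),
    l₁, hl₁, hp₁, hD₁, fun z hz hyz => ?_⟩
  have := hole.eq_of_adj hG hy (by simp) (by simp [hz]) hys hyz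
  grind

/-- A node cannot see both `s` and `t` if these are joined through two anticomplete connected sets
that avoid it. -/
theorem false_of_two_links (hG : InC2 G) {s t y : V} {D₁ D₂ : Set V} (hst : ¬ G.Adj s t)
    (hne : s ≠ t) (h₁ : SConn G D₁) (h₂ : SConn G D₂) (hs₁ : ∃ d ∈ D₁, G.Adj s d)
    (ht₁ : ∃ d ∈ D₁, G.Adj t d) (hs₂ : ∃ d ∈ D₂, G.Adj s d) (ht₂ : ∃ d ∈ D₂, G.Adj t d)
    (h : ∀ x ∈ D₁, ∀ z ∈ D₂, x ≠ z ∧ ¬ G.Adj x z) (hy₁ : y ∉ D₁) (hy₂ : y ∉ D₂)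
    (hys : G.Adj y s) (hyt : G.Adj y t) : False :=
  (exists_link_avoiding hG hst hne h₁ h₂ hs₁ ht₁ hs₂ ht₂ h hy₁ hy₂ hys hyt.ne).1 hyt

/-- No three nodes of `G` are pairwise adjacent. -/
def TriangleFree (G : SimpleGraph V) : Prop :=
  ∀ a b c, G.Adj a b → G.Adj b c → G.Adj a c → False

/-- The third node of a triangle `z`, `s`, `t` would be the center of a propeller whose rim is
formed by `s` and an induced path to `t` that avoids `z`. -/
theorem Atom.triangleFree (hG : InC2 G) (hA : Atom G Set.univ)
    (h4 : ∀ a b c : V, ∃ d, d ≠ a ∧ d ≠ b ∧ d ≠ c) : TriangleFree G := by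
  intro z s t hzs hst hzt
  obtain ⟨e, hez, hes, het⟩ := h4 z s t
  -- a neighbor `d` of `s` outside the triangle
  obtain ⟨d, hsd, hd⟩ := (hA.reach (Or.inr hzt) (a := s) (b := e) (by simp [hzs.ne', hst.ne])
    (by simp [hez, het])).exists_adj hes.symm
  have hdzt := hd.1
  simp only [Set.mem_compl_iff, Set.mem_insert_iff, Set.mem_singleton_iff, not_or] at hdzt
  obtain ⟨l, hl, hlA⟩ := (hA.reach (Or.inr hzs) (a := d) (b := t) (by simp [hdzt.1, hsd.ne'])
    (by simp [hzt.ne', hst.ne'])).exists_indPath_cons hdzt.2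
  obtain ⟨l₁, f, l₂, hlf, hf, hl₂⟩ := exists_split_last (l := d :: l) (p := G.Adj s)
    ⟨d, by simp, hsd⟩
  have e : d :: (l ++ [t]) = l₁ ++ (f :: (l₂ ++ [t])) := by
    have : d :: (l ++ [t]) = (d :: l) ++ [t] := rfl
    rw [this, hlf]; simp
  rw [e] at hl hlA
  have hp : IndPath G ((f :: l₂) ++ [t]) := (IndPath.append_iff.1 hl).2.1
  have hp' := IndPath.append_iff.1 hp
  have hn := hp.nodup
  have hmem : ∀ x ∈ f :: (l₂ ++ [t]), x ≠ z ∧ x ≠ s := fun x hx => by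
    have := hlA x (List.mem_append_right _ hx)
    simpa using this
  have hole : IsHole G s ((f :: l₂) ++ [t]) := by
    refine IsHole.of_append hp'.1 hp'.2.1 (by simp) (by simp) hp'.2.2 ?_ ?_
    · intro x hx
      refine ⟨(hmem x (by simp at hx ⊢; tauto)).2.symm, ?_⟩
      grind
    · intro x hx
      obtain rfl : x = t := by simpa using hx
      exact ⟨hst.ne, by simp [hst]⟩
  refine hst.ne (hole.eq_of_adj hG (y := z) ?_ (by simp) (by simp) hzs hzt)
  intro hh
  rcases List.mem_cons.1 hh with hh | hh
  · exact hzs.ne hh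
  · exact (hmem z (by simp at hh ⊢; tauto)).1 rfl

/-- `z` together with the clique `{c, d}` of size at most two separates the neighbors `s` and `t`
of `z`; if `c ≠ d` then the components of `s` and `t` contain neighbors of both `c` and `d`. -/
structure Separates (G : SimpleGraph V) (z c d s t : V) : Prop where
  clique : c = d ∨ G.Adj c d
  adj_left : G.Adj z s
  adj_right : G.Adj z t
  ne_left : z ≠ c
  ne_right : z ≠ d
  not_adj_left : ¬ G.Adj z c
  not_adj_right : ¬ G.Adj z d
  left_notMem : s ∉ ({z, c, d} : Set V)
  right_notMem : t ∉ ({z, c, d} : Set V)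
  not_reach : ¬ Reach G {z, c, d}ᶜ s t
  attach : c ≠ d → ∀ e ∈ ({c, d} : Set V), (∃ g ∈ comp G {z, c, d} s, G.Adj e g) ∧
    ∃ g ∈ comp G {z, c, d} t, G.Adj e g

theorem Separates.symm {z c d s t : V} (h : Separates G z c d s t) : Separates G z c d t s :=
  ⟨h.1, h.3, h.2, h.4, h.5, h.6, h.7, h.9, h.8, fun hh => h.10 hh.symm,
    fun hcd e he => (h.11 hcd e he).symm⟩

/-- In an atom, any two neighbors of a node `z` are separated by `z` and a clique `{c, d}` that
contains no neighbor of `z`. If neither `c` nor `d` is redundant, both have neighbors in the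
components of `s` and `t`; then a neighbor `c` of `z` would see both `z` and `d`, which are joined
through both components. -/
theorem Atom.exists_separates [Finite V] (hG : InC2 G) (hA : Atom G Set.univ)
    (hT : TriangleFree G) {z s t : V} (hzs : G.Adj z s) (hzt : G.Adj z t) (hst : s ≠ t) :
    ∃ c d, Separates G z c d s t := by
  have hnst : ¬ G.Adj s t := fun h => hT z s t hzs h hzt
  rcases exists_clique_separator hG hzs hzt hst hnst with h | ⟨c, d, hcd, hs, ht, hr⟩
  · refine absurd (hA.reach (Or.inl (Eq.refl z)) (a := s) (b := t) (by simp [hzs.ne'])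
      (by simp [hzt.ne'])) ?_
    simpa using h
  have hset : ({z}ᶜ : Set V) \ {c, d} = {z, c, d}ᶜ := by ext; simp
  rw [hset] at hr
  by_cases h2 : ∃ e ∈ ({c, d} : Set V), ¬ Reach G {z, e}ᶜ s t
  · -- one of `c` and `d` is redundant
    obtain ⟨e, he, hre⟩ := h2
    have hse : s ≠ e := fun h => hs (h ▸ he)
    have hte : t ≠ e := fun h => ht (h ▸ he)
    have hze : ¬ (z = e ∨ G.Adj z e) := fun h =>
      hre (hA.reach h (by simp [hzs.ne', hse]) (by simp [hzt.ne', hte]))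
    push Not at hze
    exact ⟨e, e, Or.inl rfl, hzs, hzt, hze.1, hze.1, hze.2, hze.2, by simp [hzs.ne', hse],
      by simp [hzt.ne', hte], by simpa using hre, fun h => absurd rfl h⟩
  · push Not at h2
    have hc2 := h2 c (by simp)
    have hd2 := h2 d (by simp)
    have hzc : z ≠ c := by rintro rfl; exact hr (by simpa using hd2)
    have hzd : z ≠ d := by
      rintro rfl
      have : ({z, c, z} : Set V) = {z, c} := by ext; simp; tauto
      rw [this] at hr
      exact hr hc2
    have hcned : c ≠ d := by rintro rfl; exact hr (by simpa using hd2)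
    have hcd' : G.Adj c d := hcd.resolve_left hcned
    have hs' : s ∉ ({z, c, d} : Set V) := by
      simp at hs ⊢; exact ⟨hzs.ne', hs⟩
    have ht' : t ∉ ({z, c, d} : Set V) := by
      simp at ht ⊢; exact ⟨hzt.ne', ht⟩
    have hatt : ∀ s t, s ∉ ({z, c, d} : Set V) → ¬ Reach G {z, c, d}ᶜ s t →
        (∀ e ∈ ({c, d} : Set V), Reach G {z, e}ᶜ s t) → ∀ e ∈ ({c, d} : Set V),
        ∃ g ∈ comp G {z, c, d} s, G.Adj e g := by
      intro s t hs hr h2 e he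
      by_contra hcon
      push Not at hcon
      obtain ⟨f, hf, hef⟩ : ∃ f ∈ ({c, d} : Set V), ∀ k, k ∉ ({z, f} : Set V) → k ≠ e →
          k ∉ ({z, c, d} : Set V) := by
        rcases he with rfl | rfl
        · exact ⟨d, by simp, by simp; tauto⟩
        · exact ⟨c, by simp, by simp; tauto⟩
      refine hr ((h2 f hf).mem_of_closed (D := comp G {z, c, d} s) (mem_comp_self hs) ?_)
      intro g hg k hk hgk
      refine mem_comp_of_adj hg hgk (hef k hk ?_)
      rintro rfl
      exact hcon g hg hgk.symm
    have att : ∀ e ∈ ({c, d} : Set V), (∃ g ∈ comp G {z, c, d} s, G.Adj e g) ∧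
        ∃ g ∈ comp G {z, c, d} t, G.Adj e g := fun e he =>
      ⟨hatt s t hs' hr h2 e he, hatt t s ht' (fun h => hr h.symm) (fun e he => (h2 e he).symm) e he⟩
    have hzs' : ∃ g ∈ comp G {z, c, d} s, G.Adj z g := ⟨s, mem_comp_self hs', hzs⟩
    have hzt' : ∃ g ∈ comp G {z, c, d} t, G.Adj z g := ⟨t, mem_comp_self ht', hzt⟩
    refine ⟨c, d, hcd, hzs, hzt, hzc, hzd, fun h => ?_, fun h => ?_, hs', ht', hr, fun _ => att⟩
    · exact false_of_two_links hG (s := z) (t := d) (y := c) (fun h' => hT z c d h hcd' h') hzd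
        (sConn_comp _ _) (sConn_comp _ _) hzs' (att d (by simp)).1 hzt' (att d (by simp)).2
        (comp_anticomplete hr) (fun h => notMem_of_mem_comp h (by simp))
        (fun h => notMem_of_mem_comp h (by simp)) h.symm hcd'
    · exact false_of_two_links hG (s := z) (t := c) (y := d) (fun h' => hT z c d h' hcd' h) hzc
        (sConn_comp _ _) (sConn_comp _ _) hzs' (att c (by simp)).1 hzt' (att c (by simp)).2
        (comp_anticomplete hr) (fun h => notMem_of_mem_comp h (by simp))
        (fun h => notMem_of_mem_comp h (by simp)) h.symm hcd'.symm

/-! ### Minimal sides of proper `S₂`-cutsets -/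

/-- `v` has at least three neighbors. -/
def Deg3 (G : SimpleGraph V) (v : V) : Prop :=
  ∃ a b c, G.Adj v a ∧ G.Adj v b ∧ G.Adj v c ∧ a ≠ b ∧ a ≠ c ∧ b ≠ c

/-- A reason for `G[K ∪ {u, v}]` not to be a chordless path from `u` to `v`: a node of degree at
least three in `K`, or two neighbors of `u` or of `v` in `K`. -/
def BranchSide (G : SimpleGraph V) (u v : V) (K : Set V) : Prop :=
  (∃ s ∈ K, Deg3 G s) ∨ (∃ a ∈ K, ∃ b ∈ K, a ≠ b ∧ G.Adj u a ∧ G.Adj u b) ∨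
    ∃ a ∈ K, ∃ b ∈ K, a ≠ b ∧ G.Adj v a ∧ G.Adj v b

/-- `K` is a side of a split of the cutset `{u, v}`, and neither side is a path, for a reason given
by `BranchSide`. The other side is the complement of `K ∪ {u, v}`. -/
structure IsS2Side (G : SimpleGraph V) (u v : V) (K : Set V) : Prop where
  ne : u ≠ v
  not_adj : ¬ G.Adj u v
  left_notMem : u ∉ K
  right_notMem : v ∉ K
  closed : ∀ g ∈ K, ∀ h, G.Adj g h → h ≠ u → h ≠ v → h ∈ K
  side : BranchSide G u v K
  other : BranchSide G u v (K ∪ {u, v})ᶜ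

/-- `K` is a connected side of a split of the `I`-cutset `{u, v, w}` with edge `u v`: both `K` and
some connected set `C` of the other side contain neighbors of all nodes of the cutset. -/
structure IsISide (G : SimpleGraph V) (u v w : V) (K : Set V) : Prop where
  ne_left : u ≠ w
  ne_right : v ≠ w
  adj : G.Adj u v
  not_adj_left : ¬ G.Adj u w
  not_adj_right : ¬ G.Adj v w
  disj : ∀ e ∈ ({u, v, w} : Set V), e ∉ K
  closed : ∀ g ∈ K, ∀ h, G.Adj g h → h ∉ ({u, v, w} : Set V) → h ∈ K
  conn : SConn G K
  attach : ∀ e ∈ ({u, v, w} : Set V), ∃ g ∈ K, G.Adj e g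
  other : ∃ C, SConn G C ∧ (∀ g ∈ C, g ∉ K ∧ g ∉ ({u, v, w} : Set V)) ∧
    ∀ e ∈ ({u, v, w} : Set V), ∃ g ∈ C, G.Adj e g

/-- `K` is a side of a proper `S₂`-cutset or of an `I`-cutset. -/
def IsSide (G : SimpleGraph V) (K : Set V) : Prop :=
  (∃ u v, IsS2Side G u v K) ∨ ∃ u v w, IsISide G u v w K

theorem BranchSide.symm {u v : V} {K : Set V} (h : BranchSide G u v K) : BranchSide G v u K := by
  rcases h with h | h | h
  · exact Or.inl h
  · exact Or.inr (Or.inr h)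
  · exact Or.inr (Or.inl h)

theorem BranchSide.nonempty {u v : V} {K : Set V} (h : BranchSide G u v K) : K.Nonempty := by
  rcases h with ⟨k, hk, _⟩ | ⟨k, hk, _⟩ | ⟨k, hk, _⟩ <;> exact ⟨k, hk⟩

theorem IsS2Side.symm {u v : V} {K : Set V} (h : IsS2Side G u v K) : IsS2Side G v u K :=
  ⟨h.ne.symm, fun hh => h.not_adj hh.symm, h.right_notMem, h.left_notMem,
    fun g hg k hk h1 h2 => h.closed g hg k hk h2 h1, h.side.symm, by
      rw [Set.pair_comm]; exact h.other.symm⟩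

theorem IsISide.symm {u v w : V} {K : Set V} (h : IsISide G u v w K) : IsISide G v u w K := by
  have e : ({v, u, w} : Set V) = {u, v, w} := Set.insert_comm _ _ _
  exact ⟨h.ne_right, h.ne_left, h.adj.symm, h.not_adj_right, h.not_adj_left, e ▸ h.disj,
    e ▸ h.closed, h.conn, e ▸ h.attach, e ▸ h.other⟩

/-- The component of `s` left by a separator of two neighbors of `z` is a side. For `c ≠ d` the
cutset is `{c, d, z}`; for `c = d` it is `{z, c}`, and then branch nodes on both sides are needed.
-/
theorem Separates.isSide {z c d s t : V} (h : Separates G z c d s t) (hs : Deg3 G s)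
    (ht : c = d → ∃ t' ∉ comp G {z, c, d} s, t' ∉ ({z, c, d} : Set V) ∧ Deg3 G t') :
    IsSide G (comp G {z, c, d} s) := by
  have hsD := mem_comp_self (G := G) h.left_notMem
  by_cases hcd : c = d
  · obtain ⟨t', ht'D, ht'X, ht'⟩ := ht hcd
    subst hcd
    have hset : ({z, c, c} : Set V) = {z, c} := by ext; simp
    rw [hset] at ht'D ht'X hsD ⊢
    refine Or.inl ⟨z, c, h.ne_left, h.not_adj_left, fun hh => notMem_of_mem_comp hh (by simp),
      fun hh => notMem_of_mem_comp hh (by simp), fun g hg k hk h1 h2 =>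
      mem_comp_of_adj hg hk (by simp [h1, h2]), Or.inl ⟨s, hsD, hs⟩, Or.inl ⟨t', ?_, ht'⟩⟩
    exact fun hh => hh.elim ht'D ht'X
  · have hset : ({z, c, d} : Set V) = {c, d, z} := by ext; simp; tauto
    have hatt := h.attach hcd
    have htD := mem_comp_self (G := G) h.right_notMem
    have hr := h.not_reach
    refine Or.inr ⟨c, d, z, h.ne_left.symm, h.ne_right.symm, h.clique.resolve_left hcd,
      fun hh => h.not_adj_left hh.symm, fun hh => h.not_adj_right hh.symm, ?_, ?_, sConn_comp _ _,
      ?_, comp G {z, c, d} t, sConn_comp _ _, ?_, ?_⟩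
    · intro e he hh
      exact notMem_of_mem_comp hh (hset ▸ he)
    · intro g hg k hk hkX
      exact mem_comp_of_adj hg hk (hset ▸ hkX)
    · rintro e (rfl | rfl | rfl)
      · exact (hatt _ (by simp)).1
      · exact (hatt _ (by simp)).1
      · exact ⟨s, hsD, h.adj_left⟩
    · intro g hg
      exact ⟨fun hh => (comp_anticomplete hr g hh g hg).1 rfl, hset ▸ notMem_of_mem_comp hg⟩
    · rintro e (rfl | rfl | rfl)
      · exact (hatt _ (by simp)).2
      · exact (hatt _ (by simp)).2
      · exact ⟨t, htD, h.adj_right⟩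

/-- A component that avoids the cutset of a side stays inside that side. -/
theorem comp_subset_of_closed {X S K : Set V} {s : V} (hs : s ∈ K)
    (hK : ∀ g ∈ K, ∀ h, G.Adj g h → h ∉ S → h ∈ K) (h : ∀ g ∈ comp G X s, g ∉ S) :
    comp G X s ⊆ K := by
  intro b hb
  obtain ⟨ha, hb⟩ := hb
  induction hb with
  | refl => exact hs
  | @tail c d h1 h2 ih => exact hK c ih d h2.1 (h d (Reach.tail ⟨ha, h1⟩ h2.1 h2.2))

theorem false_of_ssubset [Finite V] {K D : Set V} (hmin : ∀ D, IsSide G D → K.ncard ≤ D.ncard)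
    (hD : IsSide G D) (hDK : D ⊆ K) {x : V} (hx : x ∈ K) (hxD : x ∉ D) : False := by
  have := hmin D hD
  have := Set.ncard_lt_ncard (Set.ssubset_iff_subset_ne.2 ⟨hDK, fun h => hxD (h ▸ hx)⟩)
    (Set.toFinite K)
  omega

/-- In a minimal side of a proper `S₂`-cutset, each of the two parts separated at `z` meets the
cutset: otherwise it is a smaller side. -/
theorem IsS2Side.comp_meets [Finite V] {u v z c d s t : V} {K : Set V} (hK : IsS2Side G u v K)
    (hmin : ∀ D, IsSide G D → K.ncard ≤ D.ncard) (h : Separates G z c d s t)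
    (hz : z ∈ K ∪ {u, v}) (hs : s ∈ K ∪ {u, v}) (ht : t ∈ K ∪ {u, v}) (hs3 : Deg3 G s)
    (ht3 : Deg3 G t) : ∃ g ∈ ({u, v} : Set V), g ∈ comp G {z, c, d} s := by
  by_contra hcon
  push Not at hcon
  have hsD := mem_comp_self (G := G) h.left_notMem
  have hsK : s ∈ K := hs.resolve_right fun hh => hcon s hh hsD
  have hDK : comp G {z, c, d} s ⊆ K := comp_subset_of_closed (S := {u, v}) hsK
    (fun g hg k hk hk' => hK.closed g hg k hk (fun hh => hk' (by simp [hh]))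
      (fun hh => hk' (by simp [hh]))) fun g hg hh => hcon g hh hg
  have htD : t ∉ comp G {z, c, d} s := h.not_reach
  have hside := h.isSide hs3 fun _ => ⟨t, htD, h.right_notMem, ht3⟩
  rcases hz with hz | hz
  · exact false_of_ssubset hmin hside hDK hz fun hh => notMem_of_mem_comp hh (by simp)
  · refine false_of_ssubset hmin hside hDK (ht.resolve_right fun hh => ?_) htD
    have h1 := hK.not_adj
    have h2 := G.adj_comm u v
    have h3 := h.adj_right
    have h4 := h3.ne
    simp only [Set.mem_insert_iff, Set.mem_singleton_iff] at hz hh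
    grind

theorem SConn.reach {C X : Set V} {a b : V} (hC : SConn G C) (hCX : ∀ g ∈ C, g ∉ X) (ha : a ∉ X)
    (hb : b ∉ X) (haC : ∃ g ∈ C, G.Adj a g) (hbC : ∃ g ∈ C, G.Adj b g) : Reach G Xᶜ a b := by
  obtain ⟨g, hg, hag⟩ := haC
  obtain ⟨k, hk, hbk⟩ := hbC
  exact ((Reach.of_adj ha (hCX g hg) hag).trans ((hC g hg k hk).mono hCX)).tail hbk.symm hb

/-- If `z ∈ K` and a clique `{c, d}` outside `K` separate `s` and `u` from `t` and `v`, then `z` is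
adjacent to `u`: otherwise the component of `s` left by `{u, v, z}` is a smaller side, with cutset
`{u, z}`. -/
theorem IsS2Side.adj_of_separates [Finite V] {u v z c d s t : V} {K : Set V}
    (hK : IsS2Side G u v K) (hmin : ∀ D, IsSide G D → K.ncard ≤ D.ncard)
    (h : Separates G z c d s t) (hs : s ∈ K ∪ {u, v}) (hs3 : Deg3 G s) (ht3 : Deg3 G t)
    (hu : u ∈ comp G {z, c, d} s) (hv : v ∈ comp G {z, c, d} t) (hz : z ∈ K) (hc : c ∉ K)
    (hd : d ∉ K) : G.Adj z u := by
  by_contra hzu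
  have hanti := comp_anticomplete h.not_reach
  have hsD := mem_comp_self (G := G) h.left_notMem
  have htD := mem_comp_self (G := G) h.right_notMem
  have hsK : s ∈ K := by
    rcases hs with hs | rfl | rfl
    · exact hs
    · exact absurd h.adj_left hzu
    · exact absurd rfl (hanti s hsD s hv).1
  have hzu' : z ≠ u := fun hh => hK.left_notMem (hh ▸ hz)
  have hzv' : z ≠ v := fun hh => hK.right_notMem (hh ▸ hz)
  have hsX : s ∉ ({u, v, z} : Set V) := by
    rintro (rfl | rfl | rfl)
    · exact hK.left_notMem hsK
    · exact hK.right_notMem hsK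
    · exact h.left_notMem (by simp)
  have hE : ∀ g ∈ comp G {u, v, z} s, g ∈ K ∩ comp G {z, c, d} s := by
    intro g hg
    refine Reach.mem_of_closed hg ⟨hsK, hsD⟩ fun g hg k hk hgk => ?_
    simp only [Set.mem_compl_iff, Set.mem_insert_iff, Set.mem_singleton_iff, not_or] at hk
    have hkK := hK.closed g hg.1 k hgk hk.1 hk.2.1
    refine ⟨hkK, mem_comp_of_adj hg.2 hgk ?_⟩
    rintro (hh | rfl | rfl)
    · exact hk.2.2 hh
    · exact hc hkK
    · exact hd hkK
  refine false_of_ssubset hmin (D := comp G {u, v, z} s) (Or.inl ⟨u, z, hzu'.symm,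
    fun hh => hzu hh.symm, fun hh => notMem_of_mem_comp hh (by simp),
    fun hh => notMem_of_mem_comp hh (by simp), ?_, Or.inl ⟨s, mem_comp_self hsX, hs3⟩,
    Or.inl ⟨t, ?_, ht3⟩⟩) (fun g hg => (hE g hg).1) hz (fun hh => notMem_of_mem_comp hh (by simp))
  · intro g hg k hgk hku hkz
    refine mem_comp_of_adj hg hgk ?_
    rintro (rfl | rfl | rfl)
    · exact hku rfl
    · exact (hanti g (hE g hg).2 k hv).2 hgk
    · exact hkz rfl
  · rintro (hh | rfl | rfl)
    · exact (hanti t (hE t hh).2 t htD).1 rfl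
    · exact (hanti t hu t htD).1 rfl
    · exact h.right_notMem (by simp)

/-- A separator at `z` does not separate `u` from `v`. Otherwise it contains a node of the other
side, so `c` and `d` lie outside `K`; then `z` is adjacent to both `u` and `v`, any further
component of `K` would be attached to the edge `z u` or `z v` only, and hence `K = {z}`. -/
theorem IsS2Side.false_of_separates [Finite V] (hA : Atom G Set.univ) {u v z c d s t : V}
    {K : Set V} (hK : IsS2Side G u v K) (hmin : ∀ D, IsSide G D → K.ncard ≤ D.ncard)
    (h : Separates G z c d s t) (hz : z ∈ K ∪ {u, v}) (hs : s ∈ K ∪ {u, v})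
    (ht : t ∈ K ∪ {u, v}) (hs3 : Deg3 G s) (ht3 : Deg3 G t)
    (hu : u ∈ comp G {z, c, d} s) (hv : v ∈ comp G {z, c, d} t) : False := by
  have huT := notMem_of_mem_comp hu
  have hvT := notMem_of_mem_comp hv
  have hnr : ¬ Reach G {z, c, d}ᶜ u v := fun hh =>
    h.not_reach ((Reach.trans hu hh).trans (Reach.symm hv))
  have hzK : z ∈ K := by
    rcases hz with hz | rfl | rfl
    · exact hz
    · exact absurd (by simp) huT
    · exact absurd (by simp) hvT
  -- a component of the other side joins `u` and `v`, hence it contains `c` or `d`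
  obtain ⟨k₀, hk₀⟩ := hK.other.nonempty
  simp only [Set.mem_compl_iff, Set.mem_union, Set.mem_insert_iff, Set.mem_singleton_iff,
    not_or] at hk₀
  have hk₀C : k₀ ∈ comp G {u, v} k₀ := mem_comp_self (by simp [hk₀])
  have hCK : ∀ g ∈ comp G {u, v} k₀, g ∉ K := by
    intro g hg hgK
    refine hk₀.1 (Reach.mem_of_closed (Reach.symm hg) hgK fun g hg k hk hgk => ?_)
    exact hK.closed g hg k hgk (fun hh => hk (by simp [hh])) (fun hh => hk (by simp [hh]))
  have huC : u ∉ comp G {u, v} k₀ := fun hh => notMem_of_mem_comp hh (by simp)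
  have hvC : v ∉ comp G {u, v} k₀ := fun hh => notMem_of_mem_comp hh (by simp)
  have huA : ∃ g ∈ comp G {u, v} k₀, G.Adj u g := by
    by_contra hcon
    push Not at hcon
    refine huC (hA.mem_of_closed (Or.inl rfl) hvC hvC hk₀C hK.ne hK.ne fun g hg k hgk hk _ => ?_)
    refine mem_comp_of_adj hg hgk ?_
    rintro (rfl | rfl)
    · exact hcon g hg hgk.symm
    · exact hk rfl
  have hvA : ∃ g ∈ comp G {u, v} k₀, G.Adj v g := by
    by_contra hcon
    push Not at hcon
    refine hvC (hA.mem_of_closed (Or.inl rfl) huC huC hk₀C hK.ne.symm hK.ne.symm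
      fun g hg k hgk hk _ => ?_)
    refine mem_comp_of_adj hg hgk ?_
    rintro (rfl | rfl)
    · exact hk rfl
    · exact hcon g hg hgk.symm
  have hcd : c ∈ comp G {u, v} k₀ ∨ d ∈ comp G {u, v} k₀ := by
    by_contra hcon
    push Not at hcon
    refine hnr ((sConn_comp _ _).reach ?_ huT hvT huA hvA)
    rintro g hg (rfl | rfl | rfl)
    · exact hCK _ hg hzK
    · exact hcon.1 hg
    · exact hcon.2 hg
  have hclos : ∀ e ∈ K, ∀ f, f ∈ ({z, c, d} : Set V) → G.Adj e f → f ∈ K := fun e he f hf hef =>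
    hK.closed e he f hef (fun hh => huT (hh ▸ hf)) (fun hh => hvT (hh ▸ hf))
  have hcK : c ∉ K := by
    intro hcK
    rcases hcd with hh | hh
    · exact hCK _ hh hcK
    · rcases h.clique with rfl | hcd'
      · exact hCK _ hh hcK
      · exact hCK _ hh (hclos c hcK d (by simp) hcd')
  have hdK : d ∉ K := by
    intro hdK
    rcases hcd with hh | hh
    · rcases h.clique with rfl | hcd'
      · exact hCK _ hh hdK
      · exact hCK _ hh (hclos d hdK c (by simp) hcd'.symm)
    · exact hCK _ hh hdK
  have hzu := hK.adj_of_separates hmin h hs hs3 ht3 hu hv hzK hcK hdK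
  have hzv := hK.symm.adj_of_separates hmin h.symm (by rwa [Set.pair_comm]) ht3 hs3 hv hu hzK
    hcK hdK
  -- a further component of `K` would be attached to a clique of size at most two or join `u`, `v`
  have hKz : ∀ k ∈ K, k = z := by
    intro k hk
    by_contra hkz
    have hku : k ≠ u := fun hh => hK.left_notMem (hh ▸ hk)
    have hkv : k ≠ v := fun hh => hK.right_notMem (hh ▸ hk)
    have hkE : k ∈ comp G {u, v, z} k := mem_comp_self (by simp [hku, hkv, hkz])
    have hE : ∀ g ∈ comp G {u, v, z} k, g ∈ K := by
      intro g hg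
      refine Reach.mem_of_closed hg hk fun g hg k hk hgk => ?_
      exact hK.closed g hg k hgk (fun hh => hk (by simp [hh])) (fun hh => hk (by simp [hh]))
    have huE : u ∉ comp G {u, v, z} k := fun hh => notMem_of_mem_comp hh (by simp)
    have hvE : v ∉ comp G {u, v, z} k := fun hh => notMem_of_mem_comp hh (by simp)
    have hzE : z ∉ comp G {u, v, z} k := fun hh => notMem_of_mem_comp hh (by simp)
    by_cases h1 : ∃ g ∈ comp G {u, v, z} k, G.Adj u g
    · by_cases h2 : ∃ g ∈ comp G {u, v, z} k, G.Adj v g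
      · refine hnr ((sConn_comp _ _).reach ?_ huT hvT h1 h2)
        rintro g hg (rfl | rfl | rfl)
        · exact hzE hg
        · exact hcK (hE _ hg)
        · exact hdK (hE _ hg)
      · push Not at h2
        refine hvE (hA.mem_of_closed (Or.inr hzu) hzE huE hkE hzv.ne' hK.ne.symm
          fun g hg k hgk h3 h4 => mem_comp_of_adj hg hgk ?_)
        rintro (rfl | rfl | rfl)
        · exact h4 rfl
        · exact h2 g hg hgk.symm
        · exact h3 rfl
    · push Not at h1
      refine huE (hA.mem_of_closed (Or.inr hzv) hzE hvE hkE hzu.ne' hK.ne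
        fun g hg k hgk h3 h4 => mem_comp_of_adj hg hgk ?_)
      rintro (rfl | rfl | rfl)
      · exact h1 g hg hgk.symm
      · exact h4 rfl
      · exact h3 rfl
  rcases hK.side with ⟨x, hx, hx3⟩ | ⟨a, ha, b, hb, hab, _⟩ | ⟨a, ha, b, hb, hab, _⟩
  · obtain rfl := hKz x hx
    obtain ⟨a, b, e, hxa, hxb, hxe, hab, hae, hbe⟩ := hx3
    have key : ∀ y, G.Adj x y → y = u ∨ y = v := by
      intro y hxy
      by_contra hcon
      push Not at hcon
      exact hxy.ne (hKz y (hK.closed x hx y hxy hcon.1 hcon.2)).symm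
    have := key a hxa
    have := key b hxb
    have := key e hxe
    grind
  · exact hab ((hKz a ha).trans (hKz b hb).symm)
  · exact hab ((hKz a ha).trans (hKz b hb).symm)

/-- A minimal side of a proper `S₂`-cutset, together with the cutset, contains no node with two
neighbors of degree at least three. -/
theorem IsS2Side.eq_of_adj [Finite V] (hG : InC2 G) (hA : Atom G Set.univ)
    (hT : TriangleFree G) {u v z s t : V} {K : Set V} (hK : IsS2Side G u v K)
    (hmin : ∀ D, IsSide G D → K.ncard ≤ D.ncard)
    (hz : z ∈ K ∪ {u, v}) (hs : s ∈ K ∪ {u, v}) (ht : t ∈ K ∪ {u, v}) (hzs : G.Adj z s)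
    (hzt : G.Adj z t) (hs3 : Deg3 G s) (ht3 : Deg3 G t) : s = t := by
  by_contra hst
  obtain ⟨c, d, h⟩ := hA.exists_separates hG hT hzs hzt hst
  obtain ⟨g, hg, hgs⟩ := hK.comp_meets hmin h hz hs ht hs3 ht3
  obtain ⟨k, hk, hkt⟩ := hK.comp_meets hmin h.symm hz ht hs ht3 hs3
  have hgk : g ≠ k := (comp_anticomplete h.not_reach g hgs k hkt).1
  have hcases : (g = u ∧ k = v) ∨ (g = v ∧ k = u) := by
    simp only [Set.mem_insert_iff, Set.mem_singleton_iff] at hg hk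
    grind
  rcases hcases with ⟨rfl, rfl⟩ | ⟨rfl, rfl⟩
  · exact hK.false_of_separates hA hmin h hz hs ht hs3 ht3 hgs hkt
  · rw [Set.pair_comm] at hz hs ht
    exact hK.symm.false_of_separates hA hmin h hz hs ht hs3 ht3 hgs hkt

/-! ### Minimal sides of `I`-cutsets -/

theorem IsISide.deg3 {u v w : V} {K : Set V} (hK : IsISide G u v w K) : Deg3 G u := by
  obtain ⟨C, -, hC, hatt⟩ := hK.other
  obtain ⟨a, ha, hua⟩ := hK.attach u (by simp)
  obtain ⟨b, hb, hub⟩ := hatt u (by simp)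
  refine ⟨v, a, b, hK.adj, hua, hub, ?_, ?_, ?_⟩
  · rintro rfl; exact hK.disj _ (by simp) ha
  · rintro rfl; exact (hC _ hb).2 (by simp)
  · rintro rfl; exact (hC _ hb).1 ha

/-- In a minimal side of an `I`-cutset, each of the two parts separated at `z` meets the cutset:
otherwise it is a smaller side. -/
theorem IsISide.comp_meets [Finite V] {u v w z c d s t : V} {K : Set V} (hK : IsISide G u v w K)
    (hmin : ∀ D, IsSide G D → K.ncard ≤ D.ncard) (h : Separates G z c d s t)
    (hs : s ∈ K ∪ {u, v, w}) (ht : t ∈ K ∪ {u, v, w}) (hs3 : s ∈ K → Deg3 G s) :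
    ∃ g ∈ ({u, v, w} : Set V), g ∈ comp G {z, c, d} s := by
  by_contra hcon
  push Not at hcon
  have hsD := mem_comp_self (G := G) h.left_notMem
  have hsK : s ∈ K := hs.resolve_right fun hh => hcon s hh hsD
  have hDK : comp G {z, c, d} s ⊆ K := comp_subset_of_closed hsK hK.closed
    fun g hg hh => hcon g hh hg
  have htD : t ∉ comp G {z, c, d} s := h.not_reach
  by_cases hx : ∃ x ∈ K, x ∉ comp G {z, c, d} s
  · obtain ⟨x, hxK, hxD⟩ := hx
    refine false_of_ssubset hmin (h.isSide (hs3 hsK) fun hcd => ?_) hDK hxK hxD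
    subst hcd
    -- the separator contains at most one end of the edge `u v`; the other end is a branch node
    by_cases hu : u ∈ ({z, c, c} : Set V)
    · refine ⟨v, hcon v (by simp), fun hv => ?_, hK.symm.deg3⟩
      have h1 := h.not_adj_left
      have h2 := hK.adj
      have h3 := G.adj_comm z c
      have h4 := h2.ne
      simp only [Set.mem_insert_iff, Set.mem_singleton_iff] at hu hv
      grind
    · exact ⟨u, hcon u (by simp), hu, hK.deg3⟩
  · -- if `K` is a single component, the cutset is contained in the separator, so `t ∈ K`
    push Not at hx
    have hST : ∀ e ∈ ({u, v, w} : Set V), e ∈ ({z, c, d} : Set V) := by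
      intro e he
      by_contra heT
      obtain ⟨g, hg, heg⟩ := hK.attach e he
      exact hcon e he (mem_comp_of_adj (hx g hg) heg.symm heT)
    exact htD (hx t (ht.resolve_right fun hh => h.right_notMem (hST t hh)))

/-- If the star cutset contains the end `u` of the edge of the `I`-cutset and a node `d'` of the
other side, it does not separate `v` from `w`. -/
theorem IsISide.reach_of_left_mem (hG : InC2 G) {u v w z d' : V} {K C : Set V}
    (hK : IsISide G u v w K) (hC : SConn G C)
    (hCK : ∀ g ∈ C, g ∉ K ∧ g ∉ ({u, v, w} : Set V))
    (hatt : ∀ e ∈ ({u, v, w} : Set V), ∃ g ∈ C, G.Adj e g) (hzC : z ∉ C) (hud : G.Adj u d')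
    (hv : v ∉ ({z, u, d'} : Set V)) (hw : w ∉ ({z, u, d'} : Set V)) :
    Reach G {z, u, d'}ᶜ v w := by
  have huK := hK.disj u (by simp)
  have huC : u ∉ C := fun hh => (hCK u hh).2 (by simp)
  obtain ⟨-, l, hl, hp, hlC, hlu⟩ := exists_link_avoiding hG hK.not_adj_right hK.ne_right hC hK.conn
    (hatt v (by simp)) (hatt w (by simp)) (hK.attach v (by simp)) (hK.attach w (by simp))
    (fun x hx y hy => ⟨fun hh => (hCK x hx).1 (hh ▸ hy), fun hxy => (hCK x hx).1
      (hK.closed y hy x hxy.symm (hCK x hx).2)⟩) huC huK hK.adj hK.ne_left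
  have hconn := hp.sConn v (by simp) w (by simp)
  refine hconn.mono fun g hg => ?_
  have hg' : g = v ∨ g ∈ l ∨ g = w := by simpa using hg
  rcases hg' with rfl | hg' | rfl
  · exact hv
  · rintro (rfl | rfl | rfl)
    · exact hzC (hlC _ hg')
    · exact huC (hlC _ hg')
    · exact hlu _ hg' hud
  · exact hw

/-- If `z` and `c`, `d` outside `K` separate `k ∈ K` from `w`, then the component of `k` left by
the cutset and `z` lies inside both `K` and the component of `k` left by `z`, `c`, `d`, and it is
not attached to `w`. -/
theorem IsISide.comp_facts {u v w z c d s t k : V} {K : Set V} (hK : IsISide G u v w K)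
    (h : Separates G z c d s t) (hc : c ∉ K) (hd : d ∉ K)
    (hw : w ∈ comp G {z, c, d} t) (hk : k ∈ K) (hks : k ∈ comp G {z, c, d} s) :
    (∀ g ∈ comp G {u, v, w, z} k, g ∈ K ∩ comp G {z, c, d} s) ∧
    (∀ g ∈ comp G {u, v, w, z} k, ¬ G.Adj w g) ∧
    ∀ g ∈ comp G {u, v, w, z} k, ∀ f, G.Adj g f → f ∉ ({u, v, z} : Set V) →
      f ∈ comp G {u, v, w, z} k := by
  have hE : ∀ g ∈ comp G {u, v, w, z} k, g ∈ K ∩ comp G {z, c, d} s := by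
    intro g hg
    refine Reach.mem_of_closed hg ⟨hk, hks⟩ fun g hg f hf hgf => ?_
    simp only [Set.mem_compl_iff, Set.mem_insert_iff, Set.mem_singleton_iff, not_or] at hf
    have hfK := hK.closed g hg.1 f hgf (by simp [hf])
    refine ⟨hfK, mem_comp_of_adj hg.2 hgf ?_⟩
    rintro (hh | rfl | rfl)
    · exact hf.2.2.2 hh
    · exact hc hfK
    · exact hd hfK
  have hwE : ∀ g ∈ comp G {u, v, w, z} k, ¬ G.Adj w g := fun g hg hwg =>
    (comp_anticomplete h.not_reach g (hE g hg).2 w hw).2 hwg.symm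
  refine ⟨hE, hwE, fun g hg f hgf hf => mem_comp_of_adj hg hgf ?_⟩
  rintro (rfl | rfl | rfl | rfl)
  · exact hf (by simp)
  · exact hf (by simp)
  · exact hwE g hg hgf.symm
  · exact hf (by simp)

/-- The component of `w` outside `{u, v, z}` sees all of `u`, `v` and `z`. -/
theorem IsISide.attach_comp (hA : Atom G Set.univ) {u v w z : V} {K : Set V}
    (hK : IsISide G u v w K) (hz : z ∈ K) :
    ∀ e ∈ ({u, v, z} : Set V), ∃ g ∈ comp G {u, v, z} w, G.Adj e g := by
  obtain ⟨C, hC, hCK, hatt⟩ := hK.other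
  have hzw : z ≠ w := fun hh => hK.disj w (by simp) (hh ▸ hz)
  have hwX : w ∉ ({u, v, z} : Set V) := by simp [hK.ne_left.symm, hK.ne_right.symm, hzw.symm]
  have hwD := mem_comp_self (G := G) hwX
  have hCX : ∀ g ∈ C, g ∉ ({u, v, z} : Set V) := by
    rintro g hg (rfl | rfl | rfl)
    · exact (hCK _ hg).2 (by simp)
    · exact (hCK _ hg).2 (by simp)
    · exact (hCK _ hg).1 hz
  have hCD : ∀ g ∈ C, g ∈ comp G {u, v, z} w := by
    obtain ⟨k, hk, hwk⟩ := hatt w (by simp)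
    intro g hg
    exact (mem_comp_of_adj hwD hwk (hCX k hk)).trans ((hC k hk g hg).mono hCX)
  rintro e (rfl | rfl | rfl)
  · obtain ⟨g, hg, hgC⟩ := hatt e (by simp)
    exact ⟨g, hCD g hg, hgC⟩
  · obtain ⟨g, hg, hgC⟩ := hatt e (by simp)
    exact ⟨g, hCD g hg, hgC⟩
  · by_contra hcon
    push Not at hcon
    refine notMem_of_mem_comp (hA.mem_of_closed (e := e) (Or.inr hK.adj)
      (fun hh => notMem_of_mem_comp hh (by simp)) (fun hh => notMem_of_mem_comp hh (by simp)) hwD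
      (fun hh => hK.disj u (by simp) (hh ▸ hz)) (fun hh => hK.disj v (by simp) (hh ▸ hz))
      fun g hg k hgk h1 h2 => mem_comp_of_adj hg hgk ?_) (by simp : e ∈ ({u, v, e} : Set V))
    rintro (rfl | rfl | rfl)
    · exact h1 rfl
    · exact h2 rfl
    · exact hcon g hg hgk.symm

/-- If `z` were adjacent to `u`, then `u` would see both `z` and `v`, and these are joined through
the component of a neighbor of `v` in `K` and through the component of `w` outside `{u, v, z}`. -/
theorem IsISide.not_adj_of_separates (hG : InC2 G) (hA : Atom G Set.univ) (hT : TriangleFree G)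
    {u v w z c d s t : V} {K : Set V} (hK : IsISide G u v w K) (h : Separates G z c d s t)
    (hz : z ∈ K) (hc : c ∉ K) (hd : d ∉ K) (hv : v ∈ comp G {z, c, d} s)
    (hw : w ∈ comp G {z, c, d} t) : ¬ G.Adj z u := by
  intro hzu
  have hzv : ¬ G.Adj z v := fun hh => hT z u v hzu hK.adj hh
  have hzv' : z ≠ v := fun hh => hK.disj v (by simp) (hh ▸ hz)
  obtain ⟨k, hk, hvk⟩ := hK.attach v (by simp)
  have hkz : k ≠ z := by rintro rfl; exact hzv hvk.symm
  have hks : k ∈ comp G {z, c, d} s := by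
    refine mem_comp_of_adj hv hvk ?_
    rintro (hh | rfl | rfl)
    · exact hkz hh
    · exact hc hk
    · exact hd hk
  obtain ⟨hE, hwE, hEcl⟩ := hK.comp_facts h hc hd hw hk hks
  have hkE : k ∈ comp G {u, v, w, z} k := by
    refine mem_comp_self ?_
    rintro (rfl | rfl | rfl | hh)
    · exact hK.disj _ (by simp) hk
    · exact hK.disj _ (by simp) hk
    · exact hK.disj _ (by simp) hk
    · exact hkz hh
  have hzE : ∃ g ∈ comp G {u, v, w, z} k, G.Adj z g := by
    by_contra hcon
    push Not at hcon
    refine notMem_of_mem_comp (hA.mem_of_closed (e := w) (Or.inr hK.adj)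
      (fun hh => notMem_of_mem_comp hh (by simp)) (fun hh => notMem_of_mem_comp hh (by simp)) hkE
      hK.ne_left.symm hK.ne_right.symm
      fun g hg f hgf h1 h2 => hEcl g hg f hgf ?_) (by simp : w ∈ ({u, v, w, z} : Set V))
    rintro (rfl | rfl | rfl)
    · exact h1 rfl
    · exact h2 rfl
    · exact hcon g hg hgf.symm
  have hD := hK.attach_comp hA hz
  have hanti : ∀ x ∈ comp G {u, v, w, z} k, ∀ y ∈ comp G {u, v, z} w, x ≠ y ∧ ¬ G.Adj x y := by
    intro x hx y hy
    have hyE : y ∉ comp G {u, v, w, z} k := fun hh => notMem_of_mem_comp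
      (Reach.mem_of_closed (Reach.symm hy) hh fun g hg f hf hgf => hEcl g hg f hgf hf)
      (by simp : w ∈ ({u, v, w, z} : Set V))
    exact ⟨fun hh => hyE (hh ▸ hx), fun hxy => hyE (hEcl x hx y hxy (notMem_of_mem_comp hy))⟩
  exact false_of_two_links hG (s := z) (t := v) (y := u) hzv hzv' (sConn_comp _ _) (sConn_comp _ _)
    hzE ⟨k, hkE, hvk⟩ (hD z (by simp)) (hD v (by simp)) hanti
    (fun hh => notMem_of_mem_comp hh (by simp)) (fun hh => notMem_of_mem_comp hh (by simp))
    hzu.symm hK.adj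

/-- A separator at `z` does not separate `w` from the edge `u v`: otherwise the component of `s` in
`K ∖ {z}` is a smaller side, with cutset `{u, v, z}`, `{u, z}` or `{v, z}` according to the ends of
`u v` it is attached to. -/
theorem IsISide.false_of_separates [Finite V] (hG : InC2 G) (hA : Atom G Set.univ)
    (hT : TriangleFree G) {u v w z c d s t : V} {K : Set V} (hK : IsISide G u v w K)
    (hmin : ∀ D, IsSide G D → K.ncard ≤ D.ncard) (h : Separates G z c d s t)
    (hs : s ∈ K ∪ {u, v, w}) (hs3 : s ∈ K → Deg3 G s) (hz : z ∈ K) (hc : c ∉ K) (hd : d ∉ K)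
    (hu : u ∈ comp G {z, c, d} s) (hv : v ∈ comp G {z, c, d} s)
    (hw : w ∈ comp G {z, c, d} t) : False := by
  have hzu := hK.not_adj_of_separates hG hA hT h hz hc hd hv hw
  have hzv := hK.symm.not_adj_of_separates hG hA hT h hz hc hd hu hw
  have hsD := mem_comp_self (G := G) h.left_notMem
  have hsK : s ∈ K := by
    rcases hs with hs | rfl | rfl | rfl
    · exact hs
    · exact absurd h.adj_left hzu
    · exact absurd h.adj_left hzv
    · exact absurd hw h.symm.not_reach
  obtain ⟨hE, hwE, hEcl⟩ := hK.comp_facts h hc hd hw hsK hsD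
  have hne : ∀ e ∈ ({u, v, w} : Set V), z ≠ e := fun e he hh => hK.disj e he (hh ▸ hz)
  have hsE : s ∈ comp G {u, v, w, z} s := by
    refine mem_comp_self ?_
    rintro (rfl | rfl | rfl | rfl)
    · exact hK.disj _ (by simp) hsK
    · exact hK.disj _ (by simp) hsK
    · exact hK.disj _ (by simp) hsK
    · exact h.left_notMem (by simp)
  have hXE : ∀ e ∈ ({u, v, w, z} : Set V), e ∉ comp G {u, v, w, z} s := fun e he hh =>
    notMem_of_mem_comp hh he
  suffices hside : IsSide G (comp G {u, v, w, z} s) from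
    false_of_ssubset hmin hside (fun g hg => (hE g hg).1) hz (hXE z (by simp))
  by_cases h1 : ∃ g ∈ comp G {u, v, w, z} s, G.Adj u g
  · by_cases h2 : ∃ g ∈ comp G {u, v, w, z} s, G.Adj v g
    · refine Or.inr ⟨u, v, z, (hne u (by simp)).symm, (hne v (by simp)).symm, hK.adj,
        fun hh => hzu hh.symm, fun hh => hzv hh.symm, ?_, hEcl, sConn_comp _ _, ?_,
        comp G {u, v, z} w, sConn_comp _ _, ?_, hK.attach_comp hA hz⟩
      · rintro e (rfl | rfl | rfl) <;> exact hXE _ (by simp)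
      · rintro e (rfl | rfl | rfl)
        · exact h1
        · exact h2
        · exact ⟨s, hsE, h.adj_left⟩
      · intro g hg
        refine ⟨fun hh => hXE w (by simp) (Reach.mem_of_closed (Reach.symm hg) hh
          fun g hg f hf hgf => hEcl g hg f hgf hf), notMem_of_mem_comp hg⟩
    · push Not at h2
      refine Or.inl ⟨u, z, (hne u (by simp)).symm, fun hh => hzu hh.symm, hXE _ (by simp),
        hXE _ (by simp), fun g hg f hgf h3 h4 => hEcl g hg f hgf ?_, Or.inl ⟨s, hsE, hs3 hsK⟩,
        Or.inl ⟨v, ?_, hK.symm.deg3⟩⟩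
      · rintro (rfl | rfl | rfl)
        · exact h3 rfl
        · exact h2 g hg hgf.symm
        · exact h4 rfl
      · rintro (hh | hh | hh)
        · exact hXE v (by simp) hh
        · exact hK.adj.ne hh.symm
        · exact hne v (by simp) hh.symm
  · push Not at h1
    refine Or.inl ⟨v, z, (hne v (by simp)).symm, fun hh => hzv hh.symm, hXE _ (by simp),
      hXE _ (by simp), fun g hg f hgf h3 h4 => hEcl g hg f hgf ?_, Or.inl ⟨s, hsE, hs3 hsK⟩,
      Or.inl ⟨u, ?_, hK.deg3⟩⟩
    · rintro (rfl | rfl | rfl)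
      · exact h1 g hg hgf.symm
      · exact h3 rfl
      · exact h4 rfl
    · rintro (hh | hh | hh)
      · exact hXE u (by simp) hh
      · exact hK.adj.ne hh
      · exact hne u (by simp) hh.symm

/-- If each of the two parts separated by `z`, `c`, `d` meets the `I`-cutset, then the separator
meets both of the connected sets that join the nodes of the cutset. Hence `z` is in `K`, and
`{c, d}` meets the other side and is disjoint from `K`. -/
theorem IsISide.mem_of_separates {u v w z c d s t g k : V} {K C : Set V} (hK : IsISide G u v w K)
    (h : Separates G z c d s t) (hC : SConn G C)
    (hCK : ∀ g ∈ C, g ∉ K ∧ g ∉ ({u, v, w} : Set V))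
    (hatt : ∀ e ∈ ({u, v, w} : Set V), ∃ g ∈ C, G.Adj e g)
    (hz : z ∈ K ∪ {u, v, w}) (hg : g ∈ ({u, v, w} : Set V)) (hgs : g ∈ comp G {z, c, d} s)
    (hk : k ∈ ({u, v, w} : Set V)) (hkt : k ∈ comp G {z, c, d} t) :
    z ∈ K ∧ c ∉ K ∧ d ∉ K ∧ (c ∈ C ∨ d ∈ C) := by
  have hnr : ¬ Reach G {z, c, d}ᶜ g k := fun hh =>
    h.not_reach ((Reach.trans hgs hh).trans (Reach.symm hkt))
  have hzC : z ∉ C := fun hh => hz.elim (hCK z hh).1 (hCK z hh).2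
  have hgT := notMem_of_mem_comp hgs
  have hkT := notMem_of_mem_comp hkt
  have hcd : c ∈ C ∨ d ∈ C := by
    by_contra hcon
    push Not at hcon
    refine hnr (hC.reach ?_ hgT hkT (hatt g hg) (hatt k hk))
    rintro x hx (rfl | rfl | rfl)
    · exact hzC hx
    · exact hcon.1 hx
    · exact hcon.2 hx
  have hCcl : ∀ x ∈ C, ∀ y ∈ K, ¬ G.Adj x y := fun x hx y hy hxy =>
    (hCK x hx).1 (hK.closed y hy x hxy.symm (hCK x hx).2)
  have hcK : c ∉ K := by
    intro hcK
    rcases hcd with hh | hh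
    · exact (hCK c hh).1 hcK
    · rcases h.clique with rfl | hcd'
      · exact (hCK c hh).1 hcK
      · exact hCcl d hh c hcK hcd'.symm
  have hdK : d ∉ K := by
    intro hdK
    rcases hcd with hh | hh
    · rcases h.clique with rfl | hcd'
      · exact (hCK c hh).1 hdK
      · exact hCcl c hh d hdK hcd'
    · exact (hCK d hh).1 hdK
  refine ⟨?_, hcK, hdK, hcd⟩
  by_contra hzK
  refine hnr (hK.conn.reach ?_ hgT hkT (hK.attach g hg) (hK.attach k hk))
  rintro x hx (rfl | rfl | rfl)
  · exact hzK hx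
  · exact hcK hx
  · exact hdK hx

/-- A minimal side of an `I`-cutset, together with the cutset, contains no node with two neighbors
that are in the cutset or have degree at least three. -/
theorem IsISide.eq_of_adj [Finite V] (hG : InC2 G) (hA : Atom G Set.univ)
    (hT : TriangleFree G) {u v w z s t : V} {K : Set V} (hK : IsISide G u v w K)
    (hmin : ∀ D, IsSide G D → K.ncard ≤ D.ncard)
    (hz : z ∈ K ∪ {u, v, w}) (hs : s ∈ K ∪ {u, v, w}) (ht : t ∈ K ∪ {u, v, w})
    (hzs : G.Adj z s) (hzt : G.Adj z t) (hs3 : s ∈ K → Deg3 G s) (ht3 : t ∈ K → Deg3 G t) :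
    s = t := by
  by_contra hst
  obtain ⟨c, d, h⟩ := hA.exists_separates hG hT hzs hzt hst
  obtain ⟨g, hg, hgs⟩ := hK.comp_meets hmin h hs ht hs3
  obtain ⟨k, hk, hkt⟩ := hK.comp_meets hmin h.symm ht hs ht3
  obtain ⟨C, hC, hCK, hatt⟩ := hK.other
  obtain ⟨hzK, hcK, hdK, hcd⟩ := hK.mem_of_separates h hC hCK hatt hz hg hgs hk hkt
  have hgk := comp_anticomplete h.not_reach g hgs k hkt
  have hgk' : ¬ G.Adj k g := fun hh => hgk.2 hh.symm
  have hgT := notMem_of_mem_comp hgs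
  have hkT := notMem_of_mem_comp hkt
  have hnr : ¬ Reach G {z, c, d}ᶜ g k := fun hh =>
    h.not_reach ((Reach.trans hgs hh).trans (Reach.symm hkt))
  have hnr' : ¬ Reach G {z, c, d}ᶜ k g := fun hh => hnr hh.symm
  have hzC : z ∉ C := fun hh => (hCK z hh).1 hzK
  have hzS : ∀ e ∈ ({u, v, w} : Set V), e ≠ z := fun e he hh => hK.disj e he (hh ▸ hzK)
  -- the ends of the edge `u v` do not belong to the separator
  have main : ∀ u v, IsISide G u v w K → g ∈ ({u, v, w} : Set V) → k ∈ ({u, v, w} : Set V) →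
      (∀ g ∈ C, g ∉ K ∧ g ∉ ({u, v, w} : Set V)) →
      (∀ e ∈ ({u, v, w} : Set V), ∃ g ∈ C, G.Adj e g) → u ∉ ({z, c, d} : Set V) := by
    intro u v hK hg' hk' hCK hatt huT
    have huz : u ≠ z := fun hh => hK.disj u (by simp) (hh ▸ hzK)
    have huC : u ∉ C := fun hh => (hCK u hh).2 (by simp)
    obtain ⟨d', hd', hT'⟩ : ∃ d', G.Adj u d' ∧ ({z, c, d} : Set V) = {z, u, d'} := by
      rcases huT with hh | rfl | rfl
      · exact absurd hh huz
      · refine ⟨d, h.clique.resolve_left ?_, rfl⟩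
        rintro rfl
        exact huC (by tauto)
      · refine ⟨c, (h.clique.resolve_left ?_).symm, by ext; simp; tauto⟩
        rintro rfl
        exact huC (by tauto)
    rw [hT'] at hgT hkT hnr hnr'
    have hgu : g ≠ u := by rintro rfl; simp at hgT
    have hku : k ≠ u := by rintro rfl; simp at hkT
    have hr := hK.reach_of_left_mem hG hC hCK hatt hzC hd'
    simp only [Set.mem_insert_iff, Set.mem_singleton_iff, hgu, hku, false_or] at hg' hk'
    rcases hg' with rfl | rfl <;> rcases hk' with rfl | rfl
    · exact hgk.1 rfl
    · exact hnr (hr hgT hkT)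
    · exact hnr' (hr hkT hgT)
    · exact hgk.1 rfl
  have hperm : ({v, u, w} : Set V) = {u, v, w} := Set.insert_comm _ _ _
  have huT := main u v hK hg hk hCK hatt
  have hvT := main v u hK.symm (hperm ▸ hg) (hperm ▸ hk) (hperm ▸ hCK) (hperm ▸ hatt)
  have huv : Reach G {z, c, d}ᶜ u v := Reach.of_adj huT hvT hK.adj
  have hw : (w = g ∧ Reach G {z, c, d}ᶜ u k) ∨ (w = k ∧ Reach G {z, c, d}ᶜ u g) := by
    rcases hg with rfl | rfl | rfl <;> rcases hk with rfl | rfl | rfl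
    · exact absurd rfl hgk.1
    · exact absurd hK.adj hgk.2
    · exact Or.inr ⟨rfl, Reach.refl huT⟩
    · exact absurd hK.adj.symm hgk.2
    · exact absurd rfl hgk.1
    · exact Or.inr ⟨rfl, huv⟩
    · exact Or.inl ⟨rfl, Reach.refl huT⟩
    · exact Or.inl ⟨rfl, huv⟩
    · exact absurd rfl hgk.1
  rcases hw with ⟨rfl, hr⟩ | ⟨rfl, hr⟩
  · have hu : u ∈ comp G {z, c, d} t := Reach.trans hkt hr.symm
    exact hK.false_of_separates hG hA hT hmin h.symm ht ht3 hzK hcK hdK hu (hu.trans huv) hgs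
  · have hu : u ∈ comp G {z, c, d} s := Reach.trans hgs hr.symm
    exact hK.false_of_separates hG hA hT hmin h hs hs3 hzK hcK hdK hu (hu.trans huv) hkt

/-! ### Degrees in the cutset, and properness -/

/-- In a minimal side of a proper `S₂`-cutset, the node `u` of the cutset has two neighbors: if it
had a single neighbor `u₁`, then `K ∖ {u₁}` would be a side with cutset `{u₁, v}`. -/
theorem IsS2Side.exists_two_adj [Finite V] (hA : Atom G Set.univ) {u v : V} {K : Set V}
    (hK : IsS2Side G u v K) (hmin : ∀ D, IsSide G D → K.ncard ≤ D.ncard) :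
    ∃ a ∈ K, ∃ b ∈ K, a ≠ b ∧ G.Adj u a ∧ G.Adj u b := by
  by_contra hcon
  push Not at hcon
  obtain ⟨k₀, hk₀⟩ := hK.side.nonempty
  obtain ⟨u₁, hu₁, huu₁⟩ : ∃ k ∈ K, G.Adj u k := by
    by_contra h
    push Not at h
    exact hK.left_notMem (hA.mem_of_closed (Or.inl rfl) hK.right_notMem hK.right_notMem hk₀ hK.ne
      hK.ne fun g hg k hgk hkv _ => hK.closed g hg k hgk (fun hh => h g hg (hh ▸ hgk.symm)) hkv)
  have huniq : ∀ k ∈ K, G.Adj u k → k = u₁ := fun k hk huk => by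
    by_contra hne
    exact hcon k hk u₁ hu₁ hne huk huu₁
  have hu₁v : u₁ ≠ v := fun hh => hK.right_notMem (hh ▸ hu₁)
  have hcl : ∀ g ∈ K \ {u₁}, ∀ k, G.Adj g k → k ≠ u₁ → k ≠ v → k ∈ K \ {u₁} := by
    intro g hg k hgk h1 h2
    refine ⟨hK.closed g hg.1 k hgk ?_ h2, h1⟩
    rintro rfl
    exact hg.2 (huniq g hg.1 hgk.symm)
  have hnbr : ∀ k, G.Adj u₁ k → k ≠ u → k ≠ v → k ∈ K \ {u₁} := fun k hk h1 h2 =>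
    ⟨hK.closed u₁ hu₁ k hk h1 h2, hk.ne'⟩
  have hu₁nv : ¬ G.Adj u₁ v := by
    intro h
    -- the rest of `K` would be attached to the edge `u₁ v` only, so `K = {u₁}`
    have hKu : ∀ k ∈ K, k = u₁ := by
      intro k hk
      by_contra hne
      exact hK.left_notMem (hA.mem_of_closed (D := K \ {u₁}) (d := k) (Or.inr h) (by simp)
        (fun hh => hK.right_notMem hh.1) ⟨hk, hne⟩ huu₁.ne hK.ne hcl).1
    rcases hK.side with ⟨s, hs, a, b, c, ha, hb, hc, hab, hac, hbc⟩ | ⟨a, ha, b, hb, hab, _⟩ |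
      ⟨a, ha, b, hb, hab, _⟩
    · obtain rfl := hKu s hs
      have key : ∀ k, G.Adj s k → k = u ∨ k = v := fun k hk => by
        by_contra hne
        push Not at hne
        have := hnbr k hk hne.1 hne.2
        exact this.2 (hKu k this.1)
      have := key a ha
      have := key b hb
      have := key c hc
      grind
    · exact hab ((hKu a ha).trans (hKu b hb).symm)
    · exact hab ((hKu a ha).trans (hKu b hb).symm)
  refine false_of_ssubset hmin (D := K \ {u₁}) (Or.inl ⟨u₁, v, hu₁v, hu₁nv, by simp,
    fun hh => hK.right_notMem hh.1, hcl, ?_, ?_⟩) Set.sdiff_subset hu₁ (by simp)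
  · rcases hK.side with ⟨s, hs, hs3⟩ | ⟨a, ha, b, hb, hab, ha', hb'⟩ | ⟨a, ha, b, hb, hab, ha', hb'⟩
    · by_cases hsu : s = u₁
      · -- the role of `u₁` as a branch node is taken over by its two neighbors in `K`
        subst hsu
        obtain ⟨a, b, c, ha, hb, hc, hab, hac, hbc⟩ := hs3
        have key : ∀ k, G.Adj s k → k = u ∨ k ∈ K \ {s} := fun k hk => by
          by_cases hku : k = u
          · exact Or.inl hku
          · exact Or.inr (hnbr k hk hku fun hh => hu₁nv (hh ▸ hk))
        have h1 := key a ha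
        have h2 := key b hb
        have h3 := key c hc
        refine Or.inr (Or.inl ?_)
        rcases h1 with rfl | h1
        · exact ⟨b, h2.resolve_left hab.symm, c, h3.resolve_left hac.symm, hbc, hb, hc⟩
        · rcases h2 with rfl | h2
          · exact ⟨a, h1, c, h3.resolve_left hbc.symm, hac, ha, hc⟩
          · exact ⟨a, h1, b, h2, hab, ha, hb⟩
      · exact Or.inl ⟨s, ⟨hs, hsu⟩, hs3⟩
    · exact absurd hb' (hcon a ha b hb hab ha')
    · refine Or.inr (Or.inr ⟨a, ⟨ha, ?_⟩, b, ⟨hb, ?_⟩, hab, ha', hb'⟩)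
      · rintro rfl; exact hu₁nv ha'.symm
      · rintro rfl; exact hu₁nv hb'.symm
  · have hsub : ∀ x ∈ (K ∪ {u, v})ᶜ, x ∈ (K \ {u₁} ∪ {u₁, v})ᶜ := by
      intro x hx
      simp only [Set.mem_compl_iff, Set.mem_union, Set.mem_insert_iff, Set.mem_singleton_iff,
        Set.mem_sdiff, not_or] at hx ⊢
      exact ⟨fun h => hx.1 h.1, fun h => hx.1 (h ▸ hu₁), hx.2.2⟩
    rcases hK.other with ⟨s, hs, hs3⟩ | ⟨a, ha, b, hb, hab, ha', hb'⟩ |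
      ⟨a, ha, b, hb, hab, ha', hb'⟩
    · exact Or.inl ⟨s, hsub s hs, hs3⟩
    · -- `u` now belongs to the other side, and has `u₁` as third neighbor
      refine Or.inl ⟨u, ?_, a, b, u₁, ha', hb', huu₁, hab, ?_, ?_⟩
      · simp only [Set.mem_compl_iff, Set.mem_union, Set.mem_insert_iff, Set.mem_singleton_iff,
          Set.mem_sdiff, not_or]
        exact ⟨fun h => hK.left_notMem h.1, huu₁.ne, hK.ne⟩
      · rintro rfl; exact ha (Or.inl hu₁)
      · rintro rfl; exact hb (Or.inl hu₁)
    · exact Or.inr (Or.inr ⟨a, hsub a ha, b, hsub b hb, hab, ha', hb'⟩)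

/-- A node `y` cannot see both `u` and `w` when `{u, v, w}` is attached to a connected set `D` that
is anticomplete to `y` and to the component `E` of `k` outside `{u, v, w, y}`, for some neighbor
`k` of `v`. Depending on the attachments of `E`, one of the following pairs is joined through two
anticomplete sets avoiding a common neighbor: `u` and `w` through `D` and `E`; `u` and `w` through
a path in `D` that contains no neighbor of `v` and `E ∪ {v}`; or `v` and `y` through `E` and
`D ∪ {w}`. -/
theorem false_of_adj_left_right (hG : InC2 G) (hA : Atom G Set.univ) (hT : TriangleFree G)
    {u v w y k : V} {D : Set V} (huv : G.Adj u v) (huw : ¬ G.Adj u w) (huw' : u ≠ w)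
    (hvw' : v ≠ w) (hD : SConn G D) (hDS : ∀ g ∈ D, g ∉ ({u, v, w} : Set V))
    (hatt : ∀ e ∈ ({u, v, w} : Set V), ∃ g ∈ D, G.Adj e g) (hyv' : y ≠ v)
    (hyD : ∀ g ∈ D, g ≠ y ∧ ¬ G.Adj g y) (hvk : G.Adj v k) (hk : k ∉ ({u, v, w, y} : Set V))
    (hE : ∀ x ∈ D, ∀ g ∈ comp G {u, v, w, y} k, x ≠ g ∧ ¬ G.Adj x g)
    (hyu : G.Adj y u) (hyw : G.Adj y w) : False := by
  have hyv : ¬ G.Adj y v := fun h => hT y u v hyu huv h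
  have hkE := mem_comp_self (G := G) hk
  have hXE : ∀ e ∈ ({u, v, w, y} : Set V), e ∉ comp G {u, v, w, y} k := fun e he hh =>
    notMem_of_mem_comp hh he
  have huD : u ∉ D := fun hh => hDS u hh (by simp)
  have hvD : v ∉ D := fun hh => hDS v hh (by simp)
  have hyD' : y ∉ D := fun hh => (hyD y hh).1 rfl
  by_cases hEw : ∃ g ∈ comp G {u, v, w, y} k, G.Adj w g
  · by_cases hEu : ∃ g ∈ comp G {u, v, w, y} k, G.Adj u g
    · exact false_of_two_links hG (y := y) huw huw' hD (sConn_comp _ _) (hatt u (by simp))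
        (hatt w (by simp)) hEu hEw hE hyD' (hXE y (by simp)) hyu hyw
    · obtain ⟨-, l, hl, hp, hlD, hlv⟩ := exists_link_avoiding hG (y := v) (D₂ := {y}) huw huw' hD
        (fun a ha b hb => by
          obtain rfl : a = y := ha
          obtain rfl : b = a := hb
          exact Reach.refl rfl)
        (hatt u (by simp)) (hatt w (by simp)) ⟨y, rfl, hyu.symm⟩ ⟨y, rfl, hyw.symm⟩
        (by rintro x hx _ rfl; exact hyD x hx) hvD (fun hh => hyv' hh.symm) huv.symm hvw'
      have hul : ∃ d ∈ {z | z ∈ l}, G.Adj u d := by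
        obtain ⟨a, l, rfl⟩ := List.exists_cons_of_ne_nil hl
        exact ⟨a, by simp, (hp.2 a (by simp)).2.2 rfl⟩
      have hwl : ∃ d ∈ {z | z ∈ l}, G.Adj w d := by
        have hb := List.getLast?_eq_some_getLast hl
        generalize l.getLast hl = b at hb
        exact ⟨b, List.mem_of_getLast? hb,
          (((IndPath.append_iff.1 hp.1).2.2 b (List.mem_of_getLast? hb) w (by simp)).2.2
            ⟨hb, rfl⟩).symm⟩
      refine false_of_two_links hG (y := y) (D₂ := insert v (comp G {u, v, w, y} k)) huw huw'
        (IndPath.append_iff.1 hp.1).1.sConn ((sConn_comp _ _).insert_of_adj ⟨k, hkE, hvk⟩) hul hwl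
        ⟨v, by simp, huv⟩ ?_ ?_ (fun hh => hyD' (hlD y hh)) ?_ hyu hyw
      · obtain ⟨g, hg, hwg⟩ := hEw
        exact ⟨g, Or.inr hg, hwg⟩
      · rintro x hx z (rfl | hz)
        · exact ⟨fun hh => hvD (hh ▸ hlD x hx), fun hh => hlv x hx hh.symm⟩
        · exact hE x (hlD x hx) z hz
      · rintro (hh | hh)
        · exact hyv' hh
        · exact hXE y (by simp) hh
  · push Not at hEw
    have hEy : ∃ g ∈ comp G {u, v, w, y} k, G.Adj y g := by
      by_contra hcon
      push Not at hcon
      refine hXE w (by simp) (hA.mem_of_closed (e := w) (Or.inr huv) (hXE u (by simp))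
        (hXE v (by simp)) hkE huw'.symm hvw'.symm fun g hg f hgf h1 h2 =>
        mem_comp_of_adj hg hgf ?_)
      rintro (rfl | rfl | rfl | rfl)
      · exact h1 rfl
      · exact h2 rfl
      · exact hEw g hg hgf.symm
      · exact hcon g hg hgf.symm
    obtain ⟨g, hg, hvg⟩ := hatt v (by simp)
    refine false_of_two_links hG (s := v) (t := y) (y := u) (D₂ := insert w D)
      (fun hh => hyv hh.symm) hyv'.symm (sConn_comp {u, v, w, y} k)
      (hD.insert_of_adj (hatt w (by simp))) ⟨k, hkE, hvk⟩ hEy ⟨g, Or.inr hg, hvg⟩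
      ⟨w, by simp, hyw⟩ ?_ (hXE u (by simp)) ?_ huv hyu.symm
    · rintro x hx z (rfl | hz)
      · exact ⟨fun hh => hXE x (by simp [hh]) hx, fun hh => hEw x hx hh.symm⟩
      · exact ⟨fun hh => (hE z hz x hx).1 hh.symm, fun hh => (hE z hz x hx).2 hh.symm⟩
    · rintro (hh | hh)
      · exact huw' hh
      · exact huD hh

/-- No node outside the `I`-cutset sees both `u` and `w`. -/
theorem IsISide.not_adj_of_adj (hG : InC2 G) (hA : Atom G Set.univ) (hT : TriangleFree G)
    {u v w y : V} {K : Set V} (hK : IsISide G u v w K) (hy : y ∉ ({u, v, w} : Set V))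
    (hyu : G.Adj y u) : ¬ G.Adj y w := by
  intro hyw
  have hyv' : y ≠ v := fun hh => hy (by simp [hh])
  have hyv : ¬ G.Adj y v := fun h => hT y u v hyu hK.adj h
  obtain ⟨C, hC, hCK, hatt⟩ := hK.other
  have hcomp : ∀ {k}, k ∈ K → comp G {u, v, w, y} k ⊆ K := fun hk =>
    comp_subset_of_closed hk hK.closed fun g hg hh => notMem_of_mem_comp hg (by
      simp only [Set.mem_insert_iff, Set.mem_singleton_iff] at hh ⊢; tauto)
  have hKC : ∀ x ∈ K, ∀ g ∉ K, g ∉ ({u, v, w} : Set V) → x ≠ g ∧ ¬ G.Adj x g :=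
    fun x hx g hg hgS => ⟨fun hh => hg (hh ▸ hx), fun hh => hg (hK.closed x hx g hh hgS)⟩
  have hsep : ∀ k, G.Adj v k → k ∉ ({u, v, w} : Set V) → k ∉ ({u, v, w, y} : Set V) := by
    rintro k hvk hk (rfl | rfl | rfl | rfl)
    · exact hk (by simp)
    · exact hk (by simp)
    · exact hk (by simp)
    · exact hyv hvk.symm
  by_cases hyK : y ∈ K
  · obtain ⟨k, hk, hvk⟩ := hK.attach v (by simp)
    refine false_of_adj_left_right hG hA hT hK.adj hK.not_adj_left hK.ne_left hK.ne_right hC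
      (fun g hg => (hCK g hg).2) hatt hyv' (fun g hg => ?_) hvk
      (hsep k hvk fun hh => hK.disj k hh hk) (fun x hx g hg => ?_) hyu hyw
    · have := hKC y hyK g (hCK g hg).1 (hCK g hg).2
      exact ⟨this.1.symm, fun hh => this.2 hh.symm⟩
    · have := hKC g (hcomp hk hg) x (hCK x hx).1 (hCK x hx).2
      exact ⟨this.1.symm, fun hh => this.2 hh.symm⟩
  · obtain ⟨k, hk, hvk⟩ := hatt v (by simp)
    refine false_of_adj_left_right hG hA hT hK.adj hK.not_adj_left hK.ne_left hK.ne_right hK.conn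
      (fun g hg hh => hK.disj g hh hg) hK.attach hyv' (fun g hg => hKC g hg y hyK hy) hvk
      (hsep k hvk (hCK k hk).2) (fun x hx g hg => ?_) hyu hyw
    have hgX := notMem_of_mem_comp hg
    refine hKC x hx g (fun hgK => (hCK k hk).1 (hcomp hgK (Reach.symm hg))) fun hh => hgX ?_
    simp only [Set.mem_insert_iff, Set.mem_singleton_iff] at hh ⊢
    tauto

/-- Every `I`-cutset of a propeller-free atom without triangles is proper. -/
theorem IsISide.eq_of_adj_of_notMem (hG : InC2 G) (hA : Atom G Set.univ) (hT : TriangleFree G)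
    {u v w y a b : V} {K : Set V} (hK : IsISide G u v w K) (hy : y ∉ ({u, v, w} : Set V))
    (ha : a ∈ ({u, v, w} : Set V)) (hb : b ∈ ({u, v, w} : Set V)) (hya : G.Adj y a)
    (hyb : G.Adj y b) : a = b := by
  have h1 := hK.not_adj_of_adj hG hA hT hy
  have h2 := hK.symm.not_adj_of_adj hG hA hT (y := y) (by
    simp only [Set.mem_insert_iff, Set.mem_singleton_iff] at hy ⊢; tauto)
  have h3 := hT y u v
  have h4 := hK.adj
  simp only [Set.mem_insert_iff, Set.mem_singleton_iff] at ha hb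
  grind

/-! ### From the hypotheses to minimal sides, and from sides to splits -/

theorem deg3_iff [Finite V] {v : V} : Deg3 G v ↔ 3 ≤ deg G v := by
  rw [deg, Nat.succ_le_iff, Set.two_lt_ncard_iff (Set.toFinite _)]
  simp only [SimpleGraph.mem_neighborSet, Deg3]

theorem inC0_iff [Finite V] : InC0 G ↔
    ∀ z s t, G.Adj z s → G.Adj z t → Deg3 G s → Deg3 G t → s = t := by
  have key : ∀ z, 2 ≤ {w | G.Adj z w ∧ 3 ≤ deg G w}.ncard ↔
      ∃ s t, (G.Adj z s ∧ Deg3 G s) ∧ (G.Adj z t ∧ Deg3 G t) ∧ s ≠ t := fun z => by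
    simp only [deg3_iff]
    exact Set.one_lt_ncard_iff (Set.toFinite _)
  simp only [InC0, key]
  refine forall_congr' fun z => ⟨fun h s t h1 h2 h3 h4 => ?_, ?_⟩
  · by_contra hst
    exact h ⟨s, t, ⟨h1, h3⟩, ⟨h2, h4⟩, hst⟩
  · rintro h ⟨s, t, ⟨h1, h3⟩, ⟨h2, h4⟩, hst⟩
    exact hst (h s t h1 h2 h3 h4)

theorem Reach.of_reachable {A : Set V} {a b : A} (h : (G.induce A).Reachable a b) :
    Reach G A a b := by
  obtain ⟨p⟩ := h
  induction p with
  | nil => exact Reach.refl (Subtype.prop _)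
  | cons h p ih => exact (Reach.of_adj (Subtype.prop _) (Subtype.prop _) h).trans ih

theorem Reach.reachable {A : Set V} {a b : V} (h : Reach G A a b) (ha : a ∈ A) (hb : b ∈ A) :
    (G.induce A).Reachable ⟨a, ha⟩ ⟨b, hb⟩ := by
  obtain ⟨_, h⟩ := h
  induction h with
  | refl => exact .rfl
  | @tail c d h1 h2 ih =>
    have hc : c ∈ A := Reach.mem_right ⟨ha, h1⟩
    exact (ih hc).trans (SimpleGraph.Adj.reachable h2.1)

theorem reach_of_not_isNodeCutset {S : Set V} (h : ¬ IsNodeCutset G S) {a b : V} (ha : a ∉ S)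
    (hb : b ∉ S) : Reach G Sᶜ a b :=
  Reach.of_reachable ((not_not.1 h) ⟨a, ha⟩ ⟨b, hb⟩)

/-- A 2-connected graph without `K₂`-cutset has no clique cutset of size at most two. -/
theorem Atom.of_isKConnected (hconn : IsKConnected G 2) (hK2 : ¬ HasK2Cutset G) :
    Atom G Set.univ := by
  intro z q h a ha b hb
  rw [← Set.compl_eq_univ_sdiff] at ha hb ⊢
  refine reach_of_not_isNodeCutset (fun hcut => ?_) ha hb
  rcases h with rfl | h
  · have := hconn.2 _ (Or.inl hcut)
    simp at this
  · exact hK2 ⟨z, q, h, hcut⟩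

theorem Deg3.exists_ne {s : V} (h : Deg3 G s) (x y z : V) : ∃ d, d ≠ x ∧ d ≠ y ∧ d ≠ z := by
  classical
  obtain ⟨a, b, c, ha, hb, hc, hab, hac, hbc⟩ := h
  have h4 : ({s, a, b, c} : Finset V).card = 4 := by
    simp [Finset.card_insert_of_notMem, ha.ne, hb.ne, hc.ne, hab, hac, hbc]
  have h3 : ({x, y, z} : Finset V).card ≤ 3 := Finset.card_le_three
  obtain ⟨d, -, hd⟩ := Finset.exists_mem_notMem_of_card_lt_card
    (h3.trans_lt (Nat.lt_of_succ_le h4.ge))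
  exact ⟨d, by simpa using hd⟩

theorem exists_minimal_isSide [Finite V] (hG : InC2 G) (hA : Atom G Set.univ) (hT : TriangleFree G)
    {z s t : V} (hzs : G.Adj z s) (hzt : G.Adj z t) (hst : s ≠ t) (hs : Deg3 G s) (ht : Deg3 G t) :
    ∃ K, IsSide G K ∧ ∀ D, IsSide G D → K.ncard ≤ D.ncard := by
  obtain ⟨c, d, h⟩ := hA.exists_separates hG hT hzs hzt hst
  exact Set.exists_min_image {K | IsSide G K} Set.ncard (Set.toFinite _)
    ⟨_, h.isSide hs fun _ => ⟨t, h.not_reach, h.right_notMem, ht⟩⟩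

theorem BranchSide.not_isChordlessPath {u v : V} {K : Set V} (h : BranchSide G u v K)
    (hK : ∀ g ∈ K, ∀ h, G.Adj g h → h ≠ u → h ≠ v → h ∈ K) :
    ¬ IsChordlessPath G (K ∪ {u, v}) u v := by
  rintro ⟨n, p, hp, hu, hv⟩
  -- a node of the path has at most two neighbors on it, and an end has at most one
  have hadj : ∀ i j, G.Adj (p i) (p j) ↔ i.val + 1 = j.val ∨ j.val + 1 = i.val := fun i j => by
    rw [p.map_adj_iff, SimpleGraph.pathGraph_adj]
  have hmem : ∀ x ∈ K ∪ {u, v}, ∃ i, p i = x := fun x hx => by rwa [← hp] at hx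
  rcases h with ⟨s, hs, a, b, c, ha, hb, hc, hab, hac, hbc⟩ | ⟨a, ha, b, hb, hab, hua, hub⟩ |
    ⟨a, ha, b, hb, hab, hva, hvb⟩
  · have hS : ∀ x, G.Adj s x → x ∈ K ∪ {u, v} := fun x hx => by
      by_cases h1 : x = u
      · simp [h1]
      · by_cases h2 : x = v
        · simp [h2]
        · exact Or.inl (hK s hs x hx h1 h2)
    obtain ⟨i, rfl⟩ := hmem s (Or.inl hs)
    obtain ⟨j, rfl⟩ := hmem a (hS a ha)
    obtain ⟨k, rfl⟩ := hmem b (hS b hb)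
    obtain ⟨l, rfl⟩ := hmem c (hS c hc)
    rw [hadj] at ha hb hc
    rw [p.injective.ne_iff, Ne, Fin.ext_iff] at hab hac hbc
    omega
  · obtain ⟨j, rfl⟩ := hmem a (Or.inl ha)
    obtain ⟨k, rfl⟩ := hmem b (Or.inl hb)
    rw [← hu, hadj] at hua hub
    rw [p.injective.ne_iff, Ne, Fin.ext_iff] at hab
    simp only [Fin.val_zero] at hua hub
    omega
  · obtain ⟨j, rfl⟩ := hmem a (Or.inl ha)
    obtain ⟨k, rfl⟩ := hmem b (Or.inl hb)
    rw [← hv, hadj] at hva hvb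
    rw [p.injective.ne_iff, Ne, Fin.ext_iff] at hab
    simp only [Fin.val_last] at hva hvb
    omega

theorem IsS2Side.closed_compl {u v : V} {K : Set V} (hK : IsS2Side G u v K) :
    ∀ g ∈ (K ∪ {u, v})ᶜ, ∀ h, G.Adj g h → h ≠ u → h ≠ v → h ∈ (K ∪ {u, v})ᶜ := by
  rintro g hg h hgh h1 h2 (hh | hh | hh)
  · exact hg (Or.inl (hK.closed h hh g hgh.symm (fun e => hg (by simp [e]))
      (fun e => hg (by simp [e]))))
  · exact h1 hh
  · exact h2 hh

theorem isSplit_compl {S K : Set V} (hS : ∀ e ∈ S, e ∉ K) (hK : K.Nonempty)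
    (hC : ((K ∪ S)ᶜ : Set V).Nonempty) (hcl : ∀ g ∈ K, ∀ h, G.Adj g h → h ∉ S → h ∈ K) :
    IsSplit G S K (K ∪ S)ᶜ where
  union_eq := by
    ext x
    have := hS x
    simp only [Set.mem_union, Set.mem_compl_iff]
    tauto
  disjoint := Set.disjoint_left.2 fun x hx hh => hh (Or.inl hx)
  left_nonempty := hK
  right_nonempty := hC
  not_adj a ha b hb hab := hb (Or.inl (hcl a ha b hab fun hh => hb (Or.inr hh)))

theorem IsS2Side.isProperS2Split {u v : V} {K : Set V} (hK : IsS2Side G u v K) :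
    IsProperS2Split G u v K (K ∪ {u, v})ᶜ where
  ne := hK.ne
  not_adj := hK.not_adj
  split := isSplit_compl (by rintro e (rfl | rfl); exacts [hK.left_notMem, hK.right_notMem])
    hK.side.nonempty hK.other.nonempty fun g hg h hgh hh =>
      hK.closed g hg h hgh (fun e => hh (by simp [e])) fun e => hh (by simp [e])
  left_not_path := hK.side.not_isChordlessPath hK.closed
  right_not_path := hK.other.not_isChordlessPath hK.closed_compl

theorem SConn.hasFullComponent {S A C : Set V} (hC : SConn G C) (hCA : C ⊆ A) (hne : S.Nonempty)
    (hatt : ∀ e ∈ S, ∃ g ∈ C, G.Adj e g) : HasFullComponent G S A := by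
  obtain ⟨e, he⟩ := hne
  obtain ⟨k, hk, -⟩ := hatt e he
  refine ⟨(G.induce A).connectedComponentMk ⟨k, hCA hk⟩, fun s hs => ?_⟩
  obtain ⟨g, hg, hsg⟩ := hatt s hs
  exact ⟨⟨g, hCA hg⟩, SimpleGraph.ConnectedComponent.sound
    (((hC g hg k hk).mono hCA).reachable _ _), hsg⟩

theorem IsISide.isProperISplit [Finite V] (hG : InC2 G) (hA : Atom G Set.univ)
    (hT : TriangleFree G) {u v w : V} {K : Set V} (hK : IsISide G u v w K) :
    IsProperISplit G u v w K (K ∪ {u, v, w})ᶜ := by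
  obtain ⟨C, hC, hCK, hatt⟩ := hK.other
  have hCsub : C ⊆ (K ∪ {u, v, w})ᶜ := fun g hg hh => hh.elim (hCK g hg).1 (hCK g hg).2
  obtain ⟨k, hk, -⟩ := hK.attach u (by simp)
  obtain ⟨c, hc, -⟩ := hatt u (by simp)
  refine ⟨⟨hK.ne_left, hK.ne_right, hK.adj, hK.not_adj_left, hK.not_adj_right,
    isSplit_compl hK.disj ⟨k, hk⟩ ⟨c, hCsub hc⟩ hK.closed,
    hK.conn.hasFullComponent subset_rfl (by simp) hK.attach,
    hC.hasFullComponent hCsub (by simp) hatt⟩, fun x hx h2 => ?_⟩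
  obtain ⟨a, b, ⟨hxa, ha⟩, ⟨hxb, hb⟩, hab⟩ := (Set.one_lt_ncard_iff (Set.toFinite _)).1 h2
  exact hab (hK.eq_of_adj_of_notMem hG hA hT hx ha hb hxa hxb)

/-! ### Blocks of decomposition -/

section addPath

variable {W : Type*} {H : SimpleGraph W} {a b x y : W} {i j : Fin 2}

theorem addPath_inl_inl : (addPath H a b).Adj (.inl x) (.inl y) ↔ H.Adj x y := Iff.rfl

theorem addPath_inl_inr :
    (addPath H a b).Adj (.inl x) (.inr i) ↔ (x = a ∧ i = 0) ∨ (x = b ∧ i = 1) := Iff.rfl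

theorem addPath_inr_inl :
    (addPath H a b).Adj (.inr i) (.inl x) ↔ (x = a ∧ i = 0) ∨ (x = b ∧ i = 1) := Iff.rfl

theorem addPath_inr_inr : (addPath H a b).Adj (.inr i) (.inr j) ↔ i ≠ j := Iff.rfl

theorem eq_of_addPath_inr (hx : (addPath H a b).Adj (.inr i) (.inl x))
    (hy : (addPath H a b).Adj (.inr i) (.inl y)) : x = y := by
  rw [addPath_inr_inl] at hx hy
  grind

theorem not_deg3_addPath_inr : ¬ Deg3 (addPath H a b) (.inr i) := by
  rintro ⟨x, y, z, hx, hy, hz, hxy, hxz, hyz⟩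
  have key : ∀ {j k : Fin 2}, (addPath H a b).Adj (.inr i) (.inr j) →
      (addPath H a b).Adj (.inr i) (.inr k) → j = k := fun hj hk => by
    rw [addPath_inr_inr] at hj hk
    omega
  have key' := @eq_of_addPath_inr W H a b
  rcases x with x | x <;> rcases y with y | y <;> rcases z with z | z <;> grind

theorem Deg3.of_addPath_of_ne (h : Deg3 (addPath H a b) (.inl x)) (ha : x ≠ a) (hb : x ≠ b) :
    Deg3 H x := by
  obtain ⟨y₁, y₂, y₃, h1, h2, h3, h12, h13, h23⟩ := h
  have key : ∀ y, (addPath H a b).Adj (.inl x) y → ∃ y', y = .inl y' := by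
    rintro (y | i) hy
    · exact ⟨y, rfl⟩
    · rw [addPath_inl_inr] at hy
      grind
  obtain ⟨y₁, rfl⟩ := key y₁ h1
  obtain ⟨y₂, rfl⟩ := key y₂ h2
  obtain ⟨y₃, rfl⟩ := key y₃ h3
  exact ⟨y₁, y₂, y₃, h1, h2, h3, by grind, by grind, by grind⟩

theorem Deg3.exists_two_of_addPath (hab : a ≠ b) (h : Deg3 (addPath H a b) (.inl x)) :
    ∃ y₁ y₂, H.Adj x y₁ ∧ H.Adj x y₂ ∧ y₁ ≠ y₂ := by
  obtain ⟨y₁, y₂, y₃, h1, h2, h3, h12, h13, h23⟩ := h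
  have key : ∀ {i j}, (addPath H a b).Adj (.inl x) (.inr i) →
      (addPath H a b).Adj (.inl x) (.inr j) → i = j := fun {i j} hi hj => by
    rw [addPath_inl_inr] at hi hj
    grind
  have hl : ∀ {x y : W}, (addPath H a b).Adj (.inl x) (.inl y) → H.Adj x y := fun h => h
  rcases y₁ with y₁ | i₁ <;> rcases y₂ with y₂ | i₂ <;> rcases y₃ with y₃ | i₃ <;> grind

end addPath

theorem Deg3.of_induce {X : Set V} {x : X} (h : Deg3 (G.induce X) x) : Deg3 G x := by
  obtain ⟨a, b, c, ha, hb, hc, hab, hac, hbc⟩ := h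
  exact ⟨a, b, c, ha, hb, hc, Subtype.coe_ne_coe.2 hab, Subtype.coe_ne_coe.2 hac,
    Subtype.coe_ne_coe.2 hbc⟩

theorem IsS2Side.exists_adj_compl (hA : Atom G Set.univ) {u v : V} {K : Set V}
    (hK : IsS2Side G u v K) : ∃ g ∉ K ∪ {u, v}, G.Adj u g := by
  by_contra hcon
  push Not at hcon
  obtain ⟨d, hd⟩ := hK.other.nonempty
  exact hA.mem_of_closed (D := (K ∪ {u, v})ᶜ) (e := u) (Or.inl rfl) (by simp) (by simp) hd hK.ne
    hK.ne (fun g hg k hgk hkv _ => hK.closed_compl g hg k hgk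
      (fun hh => hcon g hg (hh ▸ hgk.symm)) hkv) (by simp)

/-- A node of the block of degree at least three has degree at least three in `G`: the marker
neighbor of a node of the cutset can be replaced by a neighbor on the other side. -/
theorem IsS2Side.deg3_of_s2Block (hA : Atom G Set.univ) {u v : V} {K : Set V}
    (hK : IsS2Side G u v K) {s : ↥(K ∪ {u, v})} (hs : Deg3 (s2Block G u v K) (.inl s)) :
    Deg3 G s := by
  have key : (∃ g ∉ K ∪ {u, v}, G.Adj s g) → Deg3 G s := by
    rintro ⟨g, hg, hsg⟩
    obtain ⟨y₁, y₂, h1, h2, h12⟩ := hs.exists_two_of_addPath (by simpa using hK.ne)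
    exact ⟨y₁, y₂, g, h1, h2, hsg, Subtype.coe_ne_coe.2 h12, fun hh => hg (hh ▸ y₁.2),
      fun hh => hg (hh ▸ y₂.2)⟩
  by_cases hsu : (s : V) = u
  · exact key (by rw [hsu]; exact hK.exists_adj_compl hA)
  · by_cases hsv : (s : V) = v
    · have := hK.symm.exists_adj_compl hA
      rw [Set.pair_comm] at this
      exact key (by rw [hsv]; exact this)
    · exact (hs.of_addPath_of_ne (fun hh => hsu (by simp [hh]))
        fun hh => hsv (by simp [hh])).of_induce

theorem IsS2Side.inC0_s2Block [Finite V] (hG : InC2 G) (hA : Atom G Set.univ) (hT : TriangleFree G)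
    {u v : V} {K : Set V} (hK : IsS2Side G u v K) (hmin : ∀ D, IsSide G D → K.ncard ≤ D.ncard) :
    InC0 (s2Block G u v K) := by
  rw [inC0_iff]
  rintro z (s | i) (t | j) hzs hzt hs ht
  · rcases z with z | i
    · exact congrArg _ (Subtype.ext (hK.eq_of_adj hG hA hT hmin z.2 s.2 t.2 hzs hzt
        (hK.deg3_of_s2Block hA hs) (hK.deg3_of_s2Block hA ht)))
    · exact congrArg _ (eq_of_addPath_inr hzs hzt)
  · exact absurd ht not_deg3_addPath_inr
  · exact absurd hs not_deg3_addPath_inr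
  · exact absurd hs not_deg3_addPath_inr

theorem IsS2Side.deg3_s2Block [Finite V] (hA : Atom G Set.univ) {u v : V} {K : Set V}
    (hK : IsS2Side G u v K) (hmin : ∀ D, IsSide G D → K.ncard ≤ D.ncard) {s : ↥(K ∪ {u, v})}
    (hs : (s : V) ∈ ({u, v} : Set V)) : Deg3 (s2Block G u v K) (.inl s) := by
  rcases hs with hs | hs
  · obtain rfl : s = ⟨u, by simp⟩ := Subtype.ext hs
    obtain ⟨a, ha, b, hb, hab, hsa, hsb⟩ := hK.exists_two_adj hA hmin
    exact ⟨.inl ⟨a, Or.inl ha⟩, .inl ⟨b, Or.inl hb⟩, .inr 0, hsa, hsb, Or.inl ⟨rfl, rfl⟩,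
      fun hh => hab (congrArg Subtype.val (Sum.inl_injective hh)), by simp, by simp⟩
  · obtain rfl : s = ⟨v, by simp⟩ := Subtype.ext hs
    obtain ⟨a, ha, b, hb, hab, hsa, hsb⟩ := hK.symm.exists_two_adj hA hmin
    exact ⟨.inl ⟨a, Or.inl ha⟩, .inl ⟨b, Or.inl hb⟩, .inr 1, hsa, hsb, Or.inr ⟨rfl, rfl⟩,
      fun hh => hab (congrArg Subtype.val (Sum.inl_injective hh)), by simp, by simp⟩

theorem IsISide.deg3_of_iBlock {u v w : V} {K : Set V} (hK : IsISide G u v w K)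
    {s : ↥(K ∪ {u, v, w})} (hs : Deg3 (iBlock G u v w K) (.inl (.inl s))) (hsK : (s : V) ∈ K) :
    Deg3 G s := by
  have hne : ∀ e ∈ ({u, v, w} : Set V), (s : V) ≠ e := fun e he hh => hK.disj e he (hh ▸ hsK)
  have key : ∀ (e : ↥(K ∪ {u, v, w})), (e : V) ∈ ({u, v, w} : Set V) → s ≠ e :=
    fun e he hh => hne e he (congrArg _ hh)
  refine ((hs.of_addPath_of_ne ?_ ?_).of_addPath_of_ne ?_ ?_).of_induce
  · exact fun hh => key _ (by simp) (Sum.inl_injective hh)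
  · exact fun hh => key _ (by simp) (Sum.inl_injective hh)
  · exact key _ (by simp)
  · exact key _ (by simp)

theorem IsISide.inC0_iBlock [Finite V] (hG : InC2 G) (hA : Atom G Set.univ) (hT : TriangleFree G)
    {u v w : V} {K : Set V} (hK : IsISide G u v w K)
    (hmin : ∀ D, IsSide G D → K.ncard ≤ D.ncard) : InC0 (iBlock G u v w K) := by
  have hinr : ∀ i, ¬ Deg3 (iBlock G u v w K) (.inl (.inr i)) := fun i hi =>
    not_deg3_addPath_inr (hi.of_addPath_of_ne (by simp) (by simp))
  rw [inC0_iff]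
  rintro z ((s | i) | i) ((t | j) | j) hzs hzt hs ht
  · rcases z with (z | i) | i
    · exact congrArg (fun x => Sum.inl (Sum.inl x)) (Subtype.ext (hK.eq_of_adj hG hA hT hmin z.2
        s.2 t.2 hzs hzt (hK.deg3_of_iBlock hs) (hK.deg3_of_iBlock ht)))
    · exact congrArg (fun x => Sum.inl (Sum.inl x)) (eq_of_addPath_inr (addPath_inl_inl.1 hzs)
        (addPath_inl_inl.1 hzt))
    · exact congrArg _ (eq_of_addPath_inr hzs hzt)
  all_goals first
    | exact absurd hs (hinr _)
    | exact absurd ht (hinr _)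
    | exact absurd hs not_deg3_addPath_inr
    | exact absurd ht not_deg3_addPath_inr

theorem IsISide.deg3_iBlock {u v w : V} {K : Set V} (hK : IsISide G u v w K)
    {s : ↥(K ∪ {u, v, w})} (hs : (s : V) ∈ ({u, v, w} : Set V)) :
    Deg3 (iBlock G u v w K) (.inl (.inl s)) := by
  obtain ⟨k, hk, hsk⟩ := hK.attach s hs
  have hkne : ∀ e ∈ ({u, v, w} : Set V), k ≠ e := fun e he hh => hK.disj e he (hh ▸ hk)
  rcases hs with hs | hs | hs
  · obtain rfl : s = ⟨u, by simp⟩ := Subtype.ext hs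
    exact ⟨.inl (.inl ⟨v, by simp⟩), .inl (.inl ⟨k, Or.inl hk⟩), .inl (.inr 0), hK.adj, hsk,
      Or.inl ⟨rfl, rfl⟩, fun hh => hkne v (by simp) (congrArg Subtype.val
        (Sum.inl_injective (Sum.inl_injective hh))).symm, by simp, by simp⟩
  · obtain rfl : s = ⟨v, by simp⟩ := Subtype.ext hs
    exact ⟨.inl (.inl ⟨u, by simp⟩), .inl (.inl ⟨k, Or.inl hk⟩), .inr 0, hK.adj.symm, hsk,
      Or.inl ⟨rfl, rfl⟩, fun hh => hkne u (by simp) (congrArg Subtype.val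
        (Sum.inl_injective (Sum.inl_injective hh))).symm, by simp, by simp⟩
  · obtain rfl : s = ⟨w, by simp⟩ := Subtype.ext hs
    exact ⟨.inl (.inl ⟨k, Or.inl hk⟩), .inl (.inr 1), .inr 1, hsk, Or.inr ⟨rfl, rfl⟩,
      Or.inr ⟨rfl, rfl⟩, by simp, by simp, by simp⟩

end PropellerFree

theorem mainTheorem6 {V : Type*} [Finite V] (G : SimpleGraph V)
    (hconn : PropellerFree.IsKConnected G 2)
    (hK2 : ¬ PropellerFree.HasK2Cutset G)
    (hC2 : PropellerFree.InC2 G)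
    (hC0 : ¬ PropellerFree.InC0 G) :
    (∃ (u v : V) (K K' : Set V),
      PropellerFree.IsProperS2Split G u v K K' ∧
      PropellerFree.InC0 (PropellerFree.s2Block G u v K) ∧
      ∀ s : ↥(K ∪ {u, v}), (s : V) ∈ ({u, v} : Set V) →
        3 ≤ PropellerFree.deg (PropellerFree.s2Block G u v K) (Sum.inl s)) ∨
    (∃ (u v w : V) (K K' : Set V),
      PropellerFree.IsProperISplit G u v w K K' ∧
      PropellerFree.InC0 (PropellerFree.iBlock G u v w K) ∧
      ∀ s : ↥(K ∪ {u, v, w}), (s : V) ∈ ({u, v, w} : Set V) →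
        3 ≤ PropellerFree.deg (PropellerFree.iBlock G u v w K) (Sum.inl (Sum.inl s))) := by
  have hA := PropellerFree.Atom.of_isKConnected hconn hK2
  rw [PropellerFree.inC0_iff] at hC0
  push Not at hC0
  obtain ⟨z, s, t, hzs, hzt, hs, ht, hst⟩ := hC0
  have hT := hA.triangleFree hC2 hs.exists_ne
  obtain ⟨K, hK, hmin⟩ := PropellerFree.exists_minimal_isSide hC2 hA hT hzs hzt hst hs ht
  rcases hK with ⟨u, v, hK⟩ | ⟨u, v, w, hK⟩
  · exact Or.inl ⟨u, v, K, _, hK.isProperS2Split, hK.inC0_s2Block hC2 hA hT hmin,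
      fun _ h => PropellerFree.deg3_iff.1 (hK.deg3_s2Block hA hmin h)⟩
  · exact Or.inr ⟨u, v, w, K, _, hK.isProperISplit hC2 hA hT, hK.inC0_iBlock hC2 hA hT hmin,
      fun _ h => PropellerFree.deg3_iff.1 (hK.deg3_iBlock h)⟩
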